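/- All algebras are associative, unital $\mathbb{C}$-algebras. Let $H$ be a Hopf algebra over $\mathbb{C}$ with comultiplication $\Delta$ and counit $\varepsilon$ (not assumed cocommutative), and let $A$ be an $H$-module algebra, i.e. an algebra with a left $H$-module structure such that $h\cdot(ab)=\sum (h_{(1)}\cdot a)(h_{(2)}\cdot b)$ and $h\cdot 1=\varepsilon(h)1$. Let $A\# H$ be the smash product: the vector space $A\otimes H$ with the multiplication $$(a\otimes h)(a'\otimes h')=\sum a\,(h_{(1)}\cdot a')\otimes h_{(2)}h'.$$ For an algebra $B$, the Arens--Michael envelope $\widehat{B}$ is the (Hausdorff) completion of $B$ with respect to the family of all submultiplicative seminorms on $B$. The $H$-completion $\widetilde{A}$ is the (Hausdorff) completion of $A$ with respect to the family of all submultiplicative seminorms $\|\cdot\|$ on $A$ that are $H$-stable, i.e. such that for each $h\in H$ there is $C>0$ with $\|h\cdot a\|\le C\|a\|$ for all $a\in A$. Write $\widehat{\otimes}$ for the completed projective tensor product of locally convex spaces. The comultiplication of $H$ and the action of $H$ on $A$ extend by continuity to $\widehat{\Delta}\colon\widehat{H}\to\widehat{H}\,\widehat{\otimes}\,\widehat{H}$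 and $\widehat{H}\,\widehat{\otimes}\,\widetilde{A}\to\widetilde{A}$. The analytic smash product $\widetilde{A}\,\widehat{\#}\,\widehat{H}$ is the space $\widetilde{A}\,\widehat{\otimes}\,\widehat{H}$ with the multiplication $$(\mu_{\widetilde{A}}\,\widehat{\otimes}\,\mu_{\widehat{H}})\circ(\mathrm{id}_{\widetilde{A}}\,\widehat{\otimes}\,\tau\,\widehat{\otimes}\,\mathrm{id}_{\widehat{H}}),$$ where $\mu$ denotes multiplication and $\tau\colon\widehat{H}\,\widehat{\otimes}\,\widetilde{A}\to\widetilde{A}\,\widehat{\otimes}\,\widehat{H}$ is the composition of $\widehat{\Delta}\,\widehat{\otimes}\,\mathrm{id}$, the flip of the last two tensor factors, and the action on the first two tensor factors (so that $\tau(h\otimes a)=\sum h_{(1)}\cdot a\otimes h_{(2)}$ for $h\in H$, $a\in A$); this is a complete Hausdorff locally convex algebra with jointly continuous multiplication. Then the canonical map $A\# H\to\widetilde{A}\,\widehat{\#}\,\widehat{H}$, $a\otimes h\mapsto a\otimes h$, extends to an isomorphism of topological algebras $$(A\# H)^{\widehat{\ }}\;\cong\;\widetilde{A}\,\widehat{\#}\,\widehat{H},$$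 that is, there is an algebra isomorphism $\Phi\colon (A\# H)^{\widehat{\ }}\to\widetilde{A}\,\widehat{\#}\,\widehat{H}$ which is a homeomorphism and whose composition with the canonical homomorphism $A\# H\to(A\# H)^{\widehat{\ }}$ is the canonical map. -/

import Mathlib

open UniformSpace Filter
open scoped TensorProduct Topology NNReal

set_option linter.unusedSectionVars false

noncomputable section

namespace ArensMichael

/-! ### Locally convex topologies given by families of seminorms, and completions -/

section SeminormTop

variable {E : Type*} [AddCommGroup E] [Module ℂ E]

/-- The vector space `E`, endowed with the locally convex topology (and the uniform structure)
generated by the family `P` of seminorms. -/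
def SeminormTop (_P : Set (Seminorm ℂ E)) : Type _ := E

variable (P : Set (Seminorm ℂ E))

instance : AddCommGroup (SeminormTop P) := inferInstanceAs (AddCommGroup E)

instance : Module ℂ (SeminormTop P) := inferInstanceAs (Module ℂ E)

/-- The identity map `E → SeminormTop P`. -/
def toSeminormTop : E ≃ₗ[ℂ] SeminormTop P := LinearEquiv.refl ℂ E

/-- A member of `P`, viewed as a seminorm on `SeminormTop P`. -/
def SeminormTop.seminorm (p : P) : Seminorm ℂ (SeminormTop P) :=
  p.1.comp (toSeminormTop P).symm.toLinearMap

instance : UniformSpace (SeminormTop P) :=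
  ⨅ p : P, (SeminormTop.seminorm P p).toSeminormedAddCommGroup.toUniformSpace

instance : IsUniformAddGroup (SeminormTop P) :=
  isUniformAddGroup_iInf fun _ => inferInstance

theorem SeminormTop.withSeminorms : WithSeminorms (SeminormTop.seminorm P) :=
  (SeminormFamily.withSeminorms_iff_uniformSpace_eq_iInf (SeminormTop.seminorm P)).2 rfl

instance : PolynormableSpace ℂ (SeminormTop P) :=
  (SeminormTop.withSeminorms P).toPolynormableSpace

instance : ContinuousSMul ℂ (SeminormTop P) := (SeminormTop.withSeminorms P).continuousSMul

instance : UniformContinuousConstSMul ℂ (SeminormTop P) :=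
  uniformContinuousConstSMul_of_continuousConstSMul _ _

/-- The (Hausdorff) completion of `E` with respect to the family `P` of seminorms. -/
abbrev SeminormCompletion : Type _ := Completion (SeminormTop P)

end SeminormTop

section CompletionOfLCS

variable (E : Type*) [AddCommGroup E] [Module ℂ E] [UniformSpace E] [IsUniformAddGroup E]
  [UniformContinuousConstSMul ℂ E]

/-- The canonical map of `E` to its completion. -/
def toComplL : E →L[ℂ] Completion E where
  toFun x := (x : Completion E)
  map_add' := Completion.coe_add
  map_smul' := Completion.coe_smul
  cont := Completion.continuous_coe E

variable {E}

@[simp]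
theorem toComplL_apply (x : E) : toComplL E x = (x : Completion E) := rfl

/-- The canonical linear map of `F` to its completion with respect to the family `P`. -/
def embed {F : Type*} [AddCommGroup F] [Module ℂ F] (P : Set (Seminorm ℂ F)) :
    F →ₗ[ℂ] SeminormCompletion P :=
  (toComplL (SeminormTop P)).toLinearMap ∘ₗ (toSeminormTop P).toLinearMap

theorem denseRange_embed {F : Type*} [AddCommGroup F] [Module ℂ F] (P : Set (Seminorm ℂ F)) :
    DenseRange (embed P) :=
  Completion.denseRange_coe (α := SeminormTop P)

theorem uniformContinuous_seminorm {p : Seminorm ℂ E} (hp : Continuous p) :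
    UniformContinuous p :=
  Seminorm.uniformContinuous_of_continuousAt_zero hp.continuousAt

/-- The continuous extension of a continuous seminorm to the completion. -/
def completionSeminorm (p : Seminorm ℂ E) (hp : Continuous p) : Seminorm ℂ (Completion E) :=
  Seminorm.of (Completion.extension p)
    (fun x y => by
      induction x, y using Completion.induction_on₂ with
      | hp =>
        exact isClosed_le (Completion.continuous_extension.comp continuous_add)
          ((Completion.continuous_extension.comp continuous_fst).add
            (Completion.continuous_extension.comp continuous_snd))
      | ih x y =>
        rw [← Completion.coe_add]
        simp only [Completion.extension_coe (uniformContinuous_seminorm hp)]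
        exact map_add_le_add p x y)
    (fun c x => by
      induction x using Completion.induction_on with
      | hp =>
        exact isClosed_eq (Completion.continuous_extension.comp (continuous_const_smul c))
          (continuous_const.mul Completion.continuous_extension)
      | ih x =>
        rw [← Completion.coe_smul]
        simp only [Completion.extension_coe (uniformContinuous_seminorm hp)]
        exact map_smul_eq_mul p c x)

theorem completionSeminorm_coe (p : Seminorm ℂ E) (hp : Continuous p) (x : E) :
    completionSeminorm p hp (x : Completion E) = p x :=
  Completion.extension_coe (uniformContinuous_seminorm hp) x

theorem continuous_completionSeminorm (p : Seminorm ℂ E) (hp : Continuous p) :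
    Continuous (completionSeminorm p hp) :=
  Completion.continuous_extension

theorem exists_seminorm_ball_subset [PolynormableSpace ℂ E] {U : Set E} (hU : U ∈ 𝓝 (0 : E)) :
    ∃ p : Seminorm ℂ E, Continuous p ∧ ∃ r > 0, p.ball 0 r ⊆ U := by
  obtain ⟨s, r, hr, h⟩ := ((PolynormableSpace.withSeminorms ℂ E).mem_nhds_iff 0 U).1 hU
  exact ⟨_, Seminorm.continuous_finsetSup fun i _ => i.2, r, hr, h⟩

theorem withSeminorms_completion [PolynormableSpace ℂ E] :
    WithSeminorms (fun p : {p : Seminorm ℂ E // Continuous p} => completionSeminorm p.1 p.2) := by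
  rw [SeminormFamily.withSeminorms_iff_nhds_eq_iInf]
  refine le_antisymm ?_ ?_
  · refine le_iInf fun p => ?_
    rw [← tendsto_iff_comap]
    exact (continuous_completionSeminorm p.1 p.2).tendsto' 0 0 (map_zero _)
  · intro U hU
    obtain ⟨V, hV, hVc, hVU⟩ := exists_mem_nhds_isClosed_subset hU
    have hV' : ((↑) : E → Completion E) ⁻¹' V ∈ 𝓝 (0 : E) :=
      (Completion.continuous_coe E).continuousAt.preimage_mem_nhds
        (by rwa [Completion.coe_zero])
    obtain ⟨p, hp, r, hr, hpr⟩ := exists_seminorm_ball_subset hV'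
    refine mem_of_superset (mem_iInf_of_mem ⟨p, hp⟩ ⟨Set.Iio r, Iio_mem_nhds hr, subset_rfl⟩) ?_
    refine Set.Subset.trans ?_ hVU
    intro x hx
    have hopen : IsOpen (completionSeminorm p hp ⁻¹' Set.Iio r) :=
      isOpen_Iio.preimage (continuous_completionSeminorm p hp)
    have hx' := (Completion.denseRange_coe (α := E)).open_subset_closure_inter hopen hx
    refine closure_minimal ?_ hVc hx'
    rintro _ ⟨hy, y, rfl⟩
    refine hpr ?_
    rw [Seminorm.mem_ball_zero, ← completionSeminorm_coe p hp]
    exact hy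

instance [PolynormableSpace ℂ E] : PolynormableSpace ℂ (Completion E) :=
  withSeminorms_completion.toPolynormableSpace

instance [PolynormableSpace ℂ E] : ContinuousSMul ℂ (Completion E) :=
  withSeminorms_completion.continuousSMul

end CompletionOfLCS

section Bilinear

variable {E F G : Type*}
  [AddCommGroup E] [Module ℂ E] [UniformSpace E] [IsUniformAddGroup E]
  [UniformContinuousConstSMul ℂ E]
  [AddCommGroup F] [Module ℂ F] [UniformSpace F] [IsUniformAddGroup F]
  [UniformContinuousConstSMul ℂ F]
  [AddCommGroup G] [Module ℂ G] [UniformSpace G] [IsUniformAddGroup G]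
  [UniformContinuousConstSMul ℂ G]

theorem continuous_bilin_of_bound {ι : Type*} {g : SeminormFamily ℂ G ι} (hg : WithSeminorms g)
    (b : E →ₗ[ℂ] F →ₗ[ℂ] G)
    (h : ∀ i, ∃ p : Seminorm ℂ E, Continuous p ∧ ∃ q : Seminorm ℂ F, Continuous q ∧
      ∀ x y, g i (b x y) ≤ p x * q y) :
    Continuous fun z : E × F => b z.1 z.2 := by
  rw [continuous_iff_continuousAt]
  rintro ⟨x₀, y₀⟩
  rw [ContinuousAt, hg.tendsto_nhds]
  intro i ε hε
  obtain ⟨p, hp, q, hq, hpq⟩ := h i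
  have hc : Continuous fun z : E × F =>
      p (z.1 - x₀) * q (z.2 - y₀) + p (z.1 - x₀) * q y₀ + p x₀ * q (z.2 - y₀) := by
    have h1 : Continuous fun z : E × F => p (z.1 - x₀) :=
      hp.comp (continuous_fst.sub continuous_const)
    have h2 : Continuous fun z : E × F => q (z.2 - y₀) :=
      hq.comp (continuous_snd.sub continuous_const)
    exact ((h1.mul h2).add (h1.mul continuous_const)).add (continuous_const.mul h2)
  have ht := hc.tendsto (x₀, y₀)
  simp only [sub_self, map_zero, zero_mul, mul_zero, add_zero] at ht
  filter_upwards [ht.eventually_lt_const hε] with z hz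
  refine lt_of_le_of_lt ?_ hz
  have key : b z.1 z.2 - b x₀ y₀
      = b (z.1 - x₀) (z.2 - y₀) + b (z.1 - x₀) y₀ + b x₀ (z.2 - y₀) := by
    simp only [map_sub, LinearMap.sub_apply]; abel
  rw [key]
  refine (map_add_le_add _ _ _).trans (add_le_add ((map_add_le_add _ _ _).trans
    (add_le_add (hpq _ _) (hpq _ _))) (hpq _ _))

theorem exists_bound_of_continuous_bilin [PolynormableSpace ℂ E] [PolynormableSpace ℂ F]
    (b : E →ₗ[ℂ] F →ₗ[ℂ] G) (hb : Continuous fun z : E × F => b z.1 z.2)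
    {r : Seminorm ℂ G} (hr : Continuous r) :
    ∃ p : Seminorm ℂ E, Continuous p ∧ ∃ q : Seminorm ℂ F, Continuous q ∧
      ∀ x y, r (b x y) ≤ p x * q y := by
  have ht : Tendsto (fun z : E × F => r (b z.1 z.2)) (𝓝 (0, 0)) (𝓝 0) :=
    (hr.comp hb).tendsto' _ _ (by simp)
  have h1 := ht.eventually_lt_const one_pos
  rw [nhds_prod_eq] at h1
  obtain ⟨U, hU, V, hV, hUV⟩ := mem_prod_iff.1 h1
  obtain ⟨p, hp, s, hs, hpU⟩ := exists_seminorm_ball_subset hU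
  obtain ⟨q, hq, t, ht, hqV⟩ := exists_seminorm_ball_subset hV
  have key : ∀ x y, p x < s → q y < t → r (b x y) < 1 := fun x y hx hy =>
    hUV (Set.mk_mem_prod (hpU ((Seminorm.mem_ball_zero p).2 hx))
      (hqV ((Seminorm.mem_ball_zero q).2 hy)))
  have hs' : Continuous ((s⁻¹).toNNReal • p) := hp.const_smul (s⁻¹).toNNReal
  have ht' : Continuous ((t⁻¹).toNNReal • q) := hq.const_smul (t⁻¹).toNNReal
  refine ⟨_, hs', _, ht', fun x y => ?_⟩
  simp only [smul_apply, NNReal.smul_def, smul_eq_mul,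
    Real.coe_toNNReal _ (inv_pos.2 hs).le, Real.coe_toNNReal _ (inv_pos.2 ht).le]
  have hlim : Tendsto (fun ε : ℝ => (s⁻¹ * p x + ε) * (t⁻¹ * q y + ε)) (𝓝[>] 0)
      (𝓝 ((s⁻¹ * p x) * (t⁻¹ * q y))) := by
    have : Continuous fun ε : ℝ => (s⁻¹ * p x + ε) * (t⁻¹ * q y + ε) := by fun_prop
    exact (this.tendsto' 0 _ (by simp)).mono_left nhdsWithin_le_nhds
  refine ge_of_tendsto hlim ?_
  filter_upwards [self_mem_nhdsWithin] with ε hε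
  have hε : 0 < ε := hε
  have hpx := apply_nonneg p x
  have hqy := apply_nonneg q y
  set α := s⁻¹ * p x + ε with hα
  set β := t⁻¹ * q y + ε with hβ
  have hα0 : 0 < α := by positivity
  have hβ0 : 0 < β := by positivity
  have h2 := key ((α⁻¹ : ℂ) • x) ((β⁻¹ : ℂ) • y)
    (by
      rw [map_smul_eq_mul, norm_inv, Complex.norm_real, Real.norm_of_nonneg hα0.le,
        inv_mul_lt_iff₀ hα0, hα, add_mul, mul_assoc, mul_comm (p x), ← mul_assoc,
        inv_mul_cancel₀ hs.ne', one_mul]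
      exact lt_add_of_pos_right _ (mul_pos hε hs))
    (by
      rw [map_smul_eq_mul, norm_inv, Complex.norm_real, Real.norm_of_nonneg hβ0.le,
        inv_mul_lt_iff₀ hβ0, hβ, add_mul, mul_assoc, mul_comm (q y), ← mul_assoc,
        inv_mul_cancel₀ ht.ne', one_mul]
      exact lt_add_of_pos_right _ (mul_pos hε ht))
  simp only [map_smul, LinearMap.smul_apply, map_smul_eq_mul, norm_inv, Complex.norm_real,
    Real.norm_of_nonneg hα0.le, Real.norm_of_nonneg hβ0.le] at h2
  rw [inv_mul_lt_iff₀ hβ0, inv_mul_lt_iff₀ hα0] at h2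
  linarith [mul_comm α β]

section extend

variable [T0Space G] [CompleteSpace G]

/-- The underlying function of `extendBilin`. -/
def extendBilinFun (b : E →ₗ[ℂ] F →ₗ[ℂ] G) (z : Completion E × Completion F) : G :=
  ((Completion.isDenseInducing_toCompl E).prodMap
    (Completion.isDenseInducing_toCompl F)).extend (fun z : E × F => b z.1 z.2) z

theorem extendBilinFun_coe (b : E →ₗ[ℂ] F →ₗ[ℂ] G)
    (hb : Continuous fun z : E × F => b z.1 z.2) (x : E) (y : F) :
    extendBilinFun b ((x : Completion E), (y : Completion F)) = b x y :=
  IsDenseInducing.extend_eq ((Completion.isDenseInducing_toCompl E).prodMap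
    (Completion.isDenseInducing_toCompl F)) hb (x, y)

/-- A bilinear map as a biadditive map. -/
def bilinToAddHom (b : E →ₗ[ℂ] F →ₗ[ℂ] G) : E →+ F →+ G :=
  AddMonoidHom.mk' (fun x => (b x).toAddMonoidHom) (fun x y => by ext z; simp)

theorem continuous_extendBilinFun (b : E →ₗ[ℂ] F →ₗ[ℂ] G)
    (hb : Continuous fun z : E × F => b z.1 z.2) : Continuous (extendBilinFun b) := by
  have hb' : Continuous fun z : E × F => bilinToAddHom b z.1 z.2 := hb
  have h := (Completion.isDenseInducing_toCompl E).extend_Z_bilin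
    (Completion.isDenseInducing_toCompl F) hb'
  exact h

theorem continuous_extendBilinFun_comp {X : Type*} [TopologicalSpace X]
    (b : E →ₗ[ℂ] F →ₗ[ℂ] G)
    (hb : Continuous fun z : E × F => b z.1 z.2) {f : X → Completion E} {g : X → Completion F}
    (hf : Continuous f) (hg : Continuous g) :
    Continuous fun x => extendBilinFun b (f x, g x) :=
  (continuous_extendBilinFun b hb).comp (hf.prodMk hg)

theorem extendBilinFun_add_left (b : E →ₗ[ℂ] F →ₗ[ℂ] G)
    (hb : Continuous fun z : E × F => b z.1 z.2) (x x' : Completion E) (y : Completion F) :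
    extendBilinFun b (x + x', y) = extendBilinFun b (x, y) + extendBilinFun b (x', y) := by
  induction x, x', y using Completion.induction_on₃ with
  | hp =>
    exact isClosed_eq
      (continuous_extendBilinFun_comp b hb (continuous_fst.add (continuous_fst.comp continuous_snd))
        (continuous_snd.comp continuous_snd))
      ((continuous_extendBilinFun_comp b hb continuous_fst (continuous_snd.comp continuous_snd)).add
        (continuous_extendBilinFun_comp b hb (continuous_fst.comp continuous_snd)
          (continuous_snd.comp continuous_snd)))
  | ih x x' y =>
    rw [← Completion.coe_add, extendBilinFun_coe b hb, extendBilinFun_coe b hb,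
      extendBilinFun_coe b hb, map_add, LinearMap.add_apply]

theorem extendBilinFun_add_right (b : E →ₗ[ℂ] F →ₗ[ℂ] G)
    (hb : Continuous fun z : E × F => b z.1 z.2) (x : Completion E) (y y' : Completion F) :
    extendBilinFun b (x, y + y') = extendBilinFun b (x, y) + extendBilinFun b (x, y') := by
  induction x, y, y' using Completion.induction_on₃ with
  | hp =>
    exact isClosed_eq
      (continuous_extendBilinFun_comp b hb continuous_fst
        ((continuous_fst.comp continuous_snd).add (continuous_snd.comp continuous_snd)))
      ((continuous_extendBilinFun_comp b hb continuous_fst (continuous_fst.comp continuous_snd)).add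
        (continuous_extendBilinFun_comp b hb continuous_fst (continuous_snd.comp continuous_snd)))
  | ih x y y' =>
    rw [← Completion.coe_add, extendBilinFun_coe b hb, extendBilinFun_coe b hb,
      extendBilinFun_coe b hb, map_add]

theorem extendBilinFun_smul_left (b : E →ₗ[ℂ] F →ₗ[ℂ] G)
    (hb : Continuous fun z : E × F => b z.1 z.2) (c : ℂ) (x : Completion E) (y : Completion F) :
    extendBilinFun b (c • x, y) = c • extendBilinFun b (x, y) := by
  induction x, y using Completion.induction_on₂ with
  | hp =>
    exact isClosed_eq
      (continuous_extendBilinFun_comp b hb (continuous_fst.const_smul c) continuous_snd)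
      ((continuous_extendBilinFun b hb).const_smul c)
  | ih x y =>
    rw [← Completion.coe_smul, extendBilinFun_coe b hb, extendBilinFun_coe b hb, map_smul,
      LinearMap.smul_apply]

theorem extendBilinFun_smul_right (b : E →ₗ[ℂ] F →ₗ[ℂ] G)
    (hb : Continuous fun z : E × F => b z.1 z.2) (c : ℂ) (x : Completion E) (y : Completion F) :
    extendBilinFun b (x, c • y) = c • extendBilinFun b (x, y) := by
  induction x, y using Completion.induction_on₂ with
  | hp =>
    exact isClosed_eq
      (continuous_extendBilinFun_comp b hb continuous_fst (continuous_snd.const_smul c))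
      ((continuous_extendBilinFun b hb).const_smul c)
  | ih x y =>
    rw [← Completion.coe_smul, extendBilinFun_coe b hb, extendBilinFun_coe b hb, map_smul]

/-- The continuous extension of a jointly continuous bilinear map to the completions. -/
def extendBilin (b : E →ₗ[ℂ] F →ₗ[ℂ] G) (hb : Continuous fun z : E × F => b z.1 z.2) :
    Completion E →ₗ[ℂ] Completion F →ₗ[ℂ] G :=
  LinearMap.mk₂ ℂ (fun x y => extendBilinFun b (x, y))
    (extendBilinFun_add_left b hb) (extendBilinFun_smul_left b hb)
    (extendBilinFun_add_right b hb) (extendBilinFun_smul_right b hb)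

theorem extendBilin_coe (b : E →ₗ[ℂ] F →ₗ[ℂ] G) (hb : Continuous fun z : E × F => b z.1 z.2)
    (x : E) (y : F) :
    extendBilin b hb (x : Completion E) (y : Completion F) = b x y :=
  extendBilinFun_coe b hb x y

theorem continuous_extendBilin (b : E →ₗ[ℂ] F →ₗ[ℂ] G)
    (hb : Continuous fun z : E × F => b z.1 z.2) :
    Continuous fun z : Completion E × Completion F => extendBilin b hb z.1 z.2 :=
  continuous_extendBilinFun b hb

end extend

end Bilinear

/-! ### The completed projective tensor product -/

section ProjectiveSeminorm

variable {E F : Type*} [AddCommGroup E] [Module ℂ E] [AddCommGroup F] [Module ℂ F]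

/-- The set of the numbers `∑ p(xᵢ) q(yᵢ)` over all representations `u = ∑ xᵢ ⊗ yᵢ`. -/
def projValues (p : Seminorm ℂ E) (q : Seminorm ℂ F) (u : E ⊗[ℂ] F) : Set ℝ :=
  {c | ∃ l : List (E × F), (l.map fun z => z.1 ⊗ₜ[ℂ] z.2).sum = u ∧
    (l.map fun z => p z.1 * q z.2).sum = c}

theorem projValues_nonneg (p : Seminorm ℂ E) (q : Seminorm ℂ F) {u : E ⊗[ℂ] F} {c : ℝ}
    (hc : c ∈ projValues p q u) : 0 ≤ c := by
  obtain ⟨l, -, rfl⟩ := hc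
  refine List.sum_nonneg fun c hc => ?_
  obtain ⟨z, -, rfl⟩ := List.mem_map.1 hc
  exact mul_nonneg (apply_nonneg p _) (apply_nonneg q _)

theorem projValues_bddBelow (p : Seminorm ℂ E) (q : Seminorm ℂ F) (u : E ⊗[ℂ] F) :
    BddBelow (projValues p q u) :=
  ⟨0, fun _ hc => projValues_nonneg p q hc⟩

theorem projValues_tmul (p : Seminorm ℂ E) (q : Seminorm ℂ F) (x : E) (y : F) :
    p x * q y ∈ projValues p q (x ⊗ₜ[ℂ] y) :=
  ⟨[(x, y)], by simp, by simp⟩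

theorem projValues_add (p : Seminorm ℂ E) (q : Seminorm ℂ F) {u v : E ⊗[ℂ] F} {c d : ℝ}
    (hc : c ∈ projValues p q u) (hd : d ∈ projValues p q v) :
    c + d ∈ projValues p q (u + v) := by
  obtain ⟨l, rfl, rfl⟩ := hc
  obtain ⟨m, rfl, rfl⟩ := hd
  exact ⟨l ++ m, by simp, by simp⟩

theorem projValues_smul (p : Seminorm ℂ E) (q : Seminorm ℂ F) (a : ℂ) {u : E ⊗[ℂ] F} {c : ℝ}
    (hc : c ∈ projValues p q u) : ‖a‖ * c ∈ projValues p q (a • u) := by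
  obtain ⟨l, rfl, rfl⟩ := hc
  refine ⟨l.map fun z => (a • z.1, z.2), ?_, ?_⟩
  · rw [List.smul_sum]; simp [Function.comp_def, TensorProduct.smul_tmul']
  · rw [← List.sum_map_mul_left]
    simp [Function.comp_def, map_smul_eq_mul, mul_assoc]

theorem projValues_nonempty (p : Seminorm ℂ E) (q : Seminorm ℂ F) (u : E ⊗[ℂ] F) :
    (projValues p q u).Nonempty := by
  induction u using TensorProduct.induction_on with
  | zero => exact ⟨0, [], by simp, by simp⟩
  | tmul x y => exact ⟨_, projValues_tmul p q x y⟩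
  | add u v hu hv =>
    obtain ⟨c, hc⟩ := hu
    obtain ⟨d, hd⟩ := hv
    exact ⟨_, projValues_add p q hc hd⟩

/-- The projective tensor product of two seminorms:
`(p ⊗ q)(u) = inf {∑ p(xᵢ) q(yᵢ) : u = ∑ xᵢ ⊗ yᵢ}`. -/
def projSeminorm (p : Seminorm ℂ E) (q : Seminorm ℂ F) : Seminorm ℂ (E ⊗[ℂ] F) :=
  Seminorm.ofSMulLE (fun u => sInf (projValues p q u))
    (le_antisymm
      (csInf_le (projValues_bddBelow p q 0) ⟨[], by simp, by simp⟩)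
      (le_csInf (projValues_nonempty p q 0) fun _ hc => projValues_nonneg p q hc))
    (fun u v => by
      refine le_of_forall_pos_le_add fun ε hε => ?_
      obtain ⟨c, hc, hc'⟩ := exists_lt_of_csInf_lt (projValues_nonempty p q u)
        (lt_add_of_pos_right _ (half_pos hε))
      obtain ⟨d, hd, hd'⟩ := exists_lt_of_csInf_lt (projValues_nonempty p q v)
        (lt_add_of_pos_right _ (half_pos hε))
      have := csInf_le (projValues_bddBelow p q (u + v)) (projValues_add p q hc hd)
      linarith)
    (fun a u => by
      rcases eq_or_ne a 0 with rfl | ha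
      · simp only [zero_smul, norm_zero, zero_mul]
        exact csInf_le (projValues_bddBelow p q 0) ⟨[], by simp, by simp⟩
      · have ha' : 0 < ‖a‖ := norm_pos_iff.2 ha
        rw [mul_comm, ← div_le_iff₀ ha']
        refine le_csInf (projValues_nonempty p q u) fun c hc => ?_
        rw [div_le_iff₀ ha', mul_comm]
        exact csInf_le (projValues_bddBelow p q _) (projValues_smul p q a hc))

theorem projSeminorm_apply (p : Seminorm ℂ E) (q : Seminorm ℂ F) (u : E ⊗[ℂ] F) :
    projSeminorm p q u = sInf (projValues p q u) := rfl

theorem projSeminorm_tmul_le (p : Seminorm ℂ E) (q : Seminorm ℂ F) (x : E) (y : F) :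
    projSeminorm p q (x ⊗ₜ[ℂ] y) ≤ p x * q y :=
  csInf_le (projValues_bddBelow p q _) (projValues_tmul p q x y)

theorem le_projSeminorm (p : Seminorm ℂ E) (q : Seminorm ℂ F) (r : Seminorm ℂ (E ⊗[ℂ] F))
    {C : ℝ} (hC : 0 ≤ C) (h : ∀ x y, r (x ⊗ₜ[ℂ] y) ≤ C * (p x * q y)) (u : E ⊗[ℂ] F) :
    r u ≤ C * projSeminorm p q u := by
  have key : ∀ l : List (E × F), r (l.map fun z => z.1 ⊗ₜ[ℂ] z.2).sum ≤
      C * (l.map fun z => p z.1 * q z.2).sum := by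
    intro l
    induction l with
    | nil => simp
    | cons z l ih =>
      simp only [List.map_cons, List.sum_cons, mul_add]
      exact (map_add_le_add r _ _).trans (add_le_add (h _ _) ih)
  rcases hC.eq_or_lt with rfl | hC
  · obtain ⟨c, l, rfl, -⟩ := projValues_nonempty p q u
    simpa using key l
  · rw [mul_comm, ← div_le_iff₀ hC]
    refine le_csInf (projValues_nonempty p q u) ?_
    rintro c ⟨l, rfl, rfl⟩
    rw [div_le_iff₀ hC, mul_comm]
    exact key l

end ProjectiveSeminorm

section ProjTensor

variable (E F : Type*)
  [AddCommGroup E] [Module ℂ E] [UniformSpace E]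
  [AddCommGroup F] [Module ℂ F] [UniformSpace F]

/-- The defining seminorms of the projective topology on `E ⊗ F`: the seminorms `p ⊗ q`, where
`p` and `q` are continuous seminorms on `E` and `F`. -/
def projSeminorms : Set (Seminorm ℂ (E ⊗[ℂ] F)) :=
  {r | ∃ p : Seminorm ℂ E, ∃ q : Seminorm ℂ F, Continuous p ∧ Continuous q ∧
    r = projSeminorm p q}

/-- The algebraic tensor product `E ⊗ F` with the projective topology. -/
abbrev ProjTensor : Type _ := SeminormTop (projSeminorms E F)

/-- The completed projective tensor product of `E` and `F`. -/
abbrev CProj : Type _ := SeminormCompletion (projSeminorms E F)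

end ProjTensor

section CProj

variable {E F G K E' F' : Type*}
  [AddCommGroup E] [Module ℂ E] [UniformSpace E] [IsUniformAddGroup E]
  [UniformContinuousConstSMul ℂ E] [PolynormableSpace ℂ E]
  [AddCommGroup F] [Module ℂ F] [UniformSpace F] [IsUniformAddGroup F]
  [UniformContinuousConstSMul ℂ F] [PolynormableSpace ℂ F]
  [AddCommGroup G] [Module ℂ G] [UniformSpace G] [IsUniformAddGroup G]
  [UniformContinuousConstSMul ℂ G] [PolynormableSpace ℂ G]
  [AddCommGroup K] [Module ℂ K] [UniformSpace K] [IsUniformAddGroup K]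
  [UniformContinuousConstSMul ℂ K] [PolynormableSpace ℂ K]
  [AddCommGroup E'] [Module ℂ E'] [UniformSpace E'] [IsUniformAddGroup E']
  [UniformContinuousConstSMul ℂ E'] [PolynormableSpace ℂ E']
  [AddCommGroup F'] [Module ℂ F'] [UniformSpace F'] [IsUniformAddGroup F']
  [UniformContinuousConstSMul ℂ F'] [PolynormableSpace ℂ F']

theorem continuous_projSeminorm {p : Seminorm ℂ E} {q : Seminorm ℂ F} (hp : Continuous p)
    (hq : Continuous q) :
    Continuous ((projSeminorm p q).comp (toSeminormTop (projSeminorms E F)).symm.toLinearMap) :=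
  (SeminormTop.withSeminorms (projSeminorms E F)).continuous_seminorm ⟨_, p, q, hp, hq, rfl⟩

variable (E F) in
/-- The canonical map of the algebraic tensor product `E ⊗ F` to `E ⊗̂ F`. -/
def toCProj : E ⊗[ℂ] F →ₗ[ℂ] CProj E F := embed (projSeminorms E F)

variable (E F) in
/-- The canonical bilinear map `E × F → E ⊗̂ F`. -/
def ctmul : E →ₗ[ℂ] F →ₗ[ℂ] CProj E F := (TensorProduct.mk ℂ E F).compr₂ (toCProj E F)

theorem toCProj_tmul (x : E) (y : F) : toCProj E F (x ⊗ₜ[ℂ] y) = ctmul E F x y := rfl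

theorem continuous_ctmul : Continuous fun z : E × F => ctmul E F z.1 z.2 := by
  have h : Continuous fun z : E × F =>
      ((TensorProduct.mk ℂ E F).compr₂ (toSeminormTop (projSeminorms E F)).toLinearMap) z.1 z.2 := by
    refine continuous_bilin_of_bound (SeminormTop.withSeminorms (projSeminorms E F)) _ ?_
    rintro ⟨_, p, q, hp, hq, rfl⟩
    exact ⟨p, hp, q, hq, fun x y => projSeminorm_tmul_le p q x y⟩
  exact (toComplL (ProjTensor E F)).continuous.comp h

theorem denseRange_toCProj : DenseRange (toCProj E F) :=
  Completion.denseRange_coe (α := ProjTensor E F)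

variable [T0Space G] [CompleteSpace G]

theorem continuous_lift_projTensor (b : E →ₗ[ℂ] F →ₗ[ℂ] G)
    (hb : Continuous fun z : E × F => b z.1 z.2) :
    Continuous ((TensorProduct.lift b) ∘ₗ
      (toSeminormTop (projSeminorms E F)).symm.toLinearMap) := by
  refine (PolynormableSpace.withSeminorms ℂ G).continuous_of_continuous_comp _ ?_
  rintro ⟨r, hr⟩
  obtain ⟨p, hp, q, hq, h⟩ := exists_bound_of_continuous_bilin b hb hr
  refine Seminorm.continuous_of_le (continuous_projSeminorm hp hq) fun u => ?_
  have := le_projSeminorm p q (r.comp (TensorProduct.lift b)) zero_le_one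
    (fun x y => by simpa using h x y) ((toSeminormTop (projSeminorms E F)).symm u)
  simpa using this

/-- The universal property of `E ⊗̂ F`: the continuous linear map `E ⊗̂ F → G` induced by a jointly
continuous bilinear map `E × F → G`. -/
def CProj.lift (b : E →ₗ[ℂ] F →ₗ[ℂ] G) (hb : Continuous fun z : E × F => b z.1 z.2) :
    CProj E F →L[ℂ] G :=
  ContinuousLinearMap.fromCompletion
    { toLinearMap := (TensorProduct.lift b) ∘ₗ (toSeminormTop (projSeminorms E F)).symm.toLinearMap
      cont := continuous_lift_projTensor b hb }

theorem CProj.lift_toCProj (b : E →ₗ[ℂ] F →ₗ[ℂ] G) (hb : Continuous fun z : E × F => b z.1 z.2)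
    (u : E ⊗[ℂ] F) : CProj.lift b hb (toCProj E F u) = TensorProduct.lift b u :=
  ContinuousLinearMap.fromCompletion_apply_coe _ _

@[simp]
theorem CProj.lift_ctmul (b : E →ₗ[ℂ] F →ₗ[ℂ] G) (hb : Continuous fun z : E × F => b z.1 z.2)
    (x : E) (y : F) : CProj.lift b hb (ctmul E F x y) = b x y := by
  rw [← toCProj_tmul, CProj.lift_toCProj, TensorProduct.lift.tmul]

/-- The completed tensor product `f ⊗̂ g` of continuous linear maps. -/
def CProj.map (f : E →L[ℂ] E') (g : F →L[ℂ] F') : CProj E F →L[ℂ] CProj E' F' :=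
  CProj.lift ((ctmul E' F').compl₁₂ f.toLinearMap g.toLinearMap)
    (continuous_ctmul.comp (f.continuous.prodMap g.continuous))

@[simp]
theorem CProj.map_ctmul (f : E →L[ℂ] E') (g : F →L[ℂ] F') (x : E) (y : F) :
    CProj.map f g (ctmul E F x y) = ctmul E' F' (f x) (g y) :=
  CProj.lift_ctmul _ _ x y

variable (E F) in
/-- The flip `E ⊗̂ F → F ⊗̂ E`. -/
def CProj.comm : CProj E F →L[ℂ] CProj F E :=
  CProj.lift (ctmul F E).flip (continuous_ctmul.comp continuous_swap)

@[simp]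
theorem CProj.comm_ctmul (x : E) (y : F) :
    CProj.comm E F (ctmul E F x y) = ctmul F E y x :=
  CProj.lift_ctmul _ _ x y

/-- The bilinear map `(E ⊗̂ F) × G → K` induced by a trilinear map `E × F × G → K`. -/
def trilinToBilin (t : E →ₗ[ℂ] F →ₗ[ℂ] K →ₗ[ℂ] G) : ProjTensor E F →ₗ[ℂ] K →ₗ[ℂ] G :=
  (TensorProduct.lift t) ∘ₗ (toSeminormTop (projSeminorms E F)).symm.toLinearMap

theorem continuous_trilinToBilin (t : E →ₗ[ℂ] F →ₗ[ℂ] K →ₗ[ℂ] G)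
    (ht : ∀ r : Seminorm ℂ G, Continuous r → ∃ p : Seminorm ℂ E, Continuous p ∧
      ∃ q : Seminorm ℂ F, Continuous q ∧ ∃ s : Seminorm ℂ K, Continuous s ∧
      ∀ x y z, r (t x y z) ≤ p x * q y * s z) :
    Continuous fun w : ProjTensor E F × K => trilinToBilin t w.1 w.2 := by
  refine continuous_bilin_of_bound (PolynormableSpace.withSeminorms ℂ G) _ ?_
  rintro ⟨r, hr⟩
  obtain ⟨p, hp, q, hq, s, hs, h⟩ := ht r hr
  refine ⟨_, continuous_projSeminorm hp hq, s, hs, fun u z => ?_⟩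
  have := le_projSeminorm p q (r.comp ((TensorProduct.lift t).flip z)) (apply_nonneg s z)
    (fun x y => by simpa [mul_comm, mul_assoc, mul_left_comm] using h x y z)
    ((toSeminormTop (projSeminorms E F)).symm u)
  rw [mul_comm]
  exact this

/-- The continuous linear map `(E ⊗̂ F) ⊗̂ K → G` induced by a jointly continuous trilinear map. -/
def CProj.lift₃ (t : E →ₗ[ℂ] F →ₗ[ℂ] K →ₗ[ℂ] G)
    (ht : ∀ r : Seminorm ℂ G, Continuous r → ∃ p : Seminorm ℂ E, Continuous p ∧
      ∃ q : Seminorm ℂ F, Continuous q ∧ ∃ s : Seminorm ℂ K, Continuous s ∧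
      ∀ x y z, r (t x y z) ≤ p x * q y * s z) : CProj (CProj E F) K →L[ℂ] G :=
  CProj.lift (E := CProj E F)
    ((extendBilin (trilinToBilin t) (continuous_trilinToBilin t ht)).compl₂
      (toComplL K).toLinearMap)
    ((continuous_extendBilin (trilinToBilin t) (continuous_trilinToBilin t ht)).comp
      (continuous_fst.prodMk ((toComplL K).continuous.comp continuous_snd)))

theorem CProj.lift₃_ctmul (t : E →ₗ[ℂ] F →ₗ[ℂ] K →ₗ[ℂ] G)
    (ht : ∀ r : Seminorm ℂ G, Continuous r → ∃ p : Seminorm ℂ E, Continuous p ∧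
      ∃ q : Seminorm ℂ F, Continuous q ∧ ∃ s : Seminorm ℂ K, Continuous s ∧
      ∀ x y z, r (t x y z) ≤ p x * q y * s z) (x : E) (y : F) (z : K) :
    CProj.lift₃ t ht (ctmul _ _ (ctmul E F x y) z) = t x y z := by
  refine (CProj.lift_ctmul (E := CProj E F) _ _ _ _).trans ?_
  exact extendBilin_coe (trilinToBilin t) (continuous_trilinToBilin t ht)
    (toSeminormTop (projSeminorms E F) (x ⊗ₜ[ℂ] y)) z

variable (E F K) in
/-- The trilinear map `(x, y, z) ↦ x ⊗ (y ⊗ z)`. -/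
def ctmul₃ : E →ₗ[ℂ] F →ₗ[ℂ] K →ₗ[ℂ] CProj E (CProj F K) :=
  LinearMap.mk₂ ℂ (fun x y => (ctmul E (CProj F K) x) ∘ₗ (ctmul F K y))
    (fun x x' y => by ext z; simp) (fun c x y => by ext z; simp)
    (fun x y y' => by ext z; simp) (fun c x y => by ext z; simp)

theorem ctmul₃_bound (r : Seminorm ℂ (CProj E (CProj F K))) (hr : Continuous r) :
    ∃ p : Seminorm ℂ E, Continuous p ∧
      ∃ q : Seminorm ℂ F, Continuous q ∧ ∃ s : Seminorm ℂ K, Continuous s ∧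
      ∀ x y z, r (ctmul₃ E F K x y z) ≤ p x * q y * s z := by
  obtain ⟨p, hp, w, hw, h⟩ :=
    exists_bound_of_continuous_bilin (ctmul E (CProj F K)) continuous_ctmul hr
  obtain ⟨q, hq, s, hs, h'⟩ := exists_bound_of_continuous_bilin (ctmul F K) continuous_ctmul hw
  refine ⟨p, hp, q, hq, s, hs, fun x y z => (h x _).trans ?_⟩
  rw [mul_assoc]
  exact mul_le_mul_of_nonneg_left (h' y z) (apply_nonneg p x)

variable (E F K) in
/-- The associativity map `(E ⊗̂ F) ⊗̂ K → E ⊗̂ (F ⊗̂ K)`. -/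
def CProj.assoc : CProj (CProj E F) K →L[ℂ] CProj E (CProj F K) :=
  CProj.lift₃ (ctmul₃ E F K) ctmul₃_bound

@[simp]
theorem CProj.assoc_ctmul (x : E) (y : F) (z : K) :
    CProj.assoc E F K (ctmul _ _ (ctmul E F x y) z) = ctmul _ _ x (ctmul F K y z) :=
  CProj.lift₃_ctmul _ _ x y z

variable (E F K) in
/-- The associativity map `E ⊗̂ (F ⊗̂ K) → (E ⊗̂ F) ⊗̂ K`, the inverse of `CProj.assoc`. -/
def CProj.assocInv : CProj E (CProj F K) →L[ℂ] CProj (CProj E F) K :=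
  (CProj.comm K (CProj E F)) ∘L (CProj.assoc K E F) ∘L (CProj.comm F (CProj K E)) ∘L
    (CProj.assoc F K E) ∘L (CProj.comm E (CProj F K))

@[simp]
theorem CProj.assocInv_ctmul (x : E) (y : F) (z : K) :
    CProj.assocInv E F K (ctmul _ _ x (ctmul F K y z)) = ctmul _ _ (ctmul E F x y) z := by
  simp [CProj.assocInv]

end CProj

/-! ### Module algebras and the smash product -/

section Smash

variable (H A : Type*) [Ring H] [Bialgebra ℂ H] [Ring A] [Algebra ℂ A] [Module H A]
  [IsScalarTower ℂ H A]

/-- The action of `H` on `A` as a bilinear map. -/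
def actionBilin : H →ₗ[ℂ] A →ₗ[ℂ] A := (Algebra.lsmul ℂ ℂ A).toLinearMap

@[simp]
theorem actionBilin_apply (h : H) (a : A) : actionBilin H A h a = h • a := rfl

/-- `A` is an `H`-module algebra: the product `A ⊗ A → A` and the unit map `ℂ → A` are morphisms of
`H`-modules, i.e. `h • (a b) = ∑ (h₍₁₎ • a) (h₍₂₎ • b)` and `h • 1 = ε(h) 1`. -/
class IsModuleAlgebra : Prop where
  smul_mul : ∀ (h : H) (a b : A), h • (a * b) =
    LinearMap.mul' ℂ A (TensorProduct.map ((actionBilin H A).flip a) ((actionBilin H A).flip b)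
      (Coalgebra.comul (R := ℂ) h))
  smul_one : ∀ h : H, h • (1 : A) = algebraMap ℂ A (Coalgebra.counit (R := ℂ) h)

/-- The map `τ : H ⊗ A → A ⊗ H`, `τ(h ⊗ a) = ∑ h₍₁₎ • a ⊗ h₍₂₎`, as the composition
`H ⊗ A → (H ⊗ H) ⊗ A → H ⊗ (H ⊗ A) → H ⊗ (A ⊗ H) → (H ⊗ A) ⊗ H → A ⊗ H`. -/
def smashTau : H ⊗[ℂ] A →ₗ[ℂ] A ⊗[ℂ] H :=
  TensorProduct.map (TensorProduct.lift (actionBilin H A)) LinearMap.id ∘ₗ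
  (TensorProduct.assoc ℂ H A H).symm.toLinearMap ∘ₗ
  TensorProduct.map LinearMap.id (TensorProduct.comm ℂ H A).toLinearMap ∘ₗ
  (TensorProduct.assoc ℂ H H A).toLinearMap ∘ₗ
  TensorProduct.map (Coalgebra.comul (R := ℂ)) LinearMap.id

/-- The map `id ⊗ μ_H` preceded by `τ ⊗ id`: `H ⊗ (A ⊗ H) → A ⊗ H`,
`h ⊗ (a ⊗ k) ↦ ∑ h₍₁₎ • a ⊗ h₍₂₎ k`. -/
def smashInner : H ⊗[ℂ] (A ⊗[ℂ] H) →ₗ[ℂ] A ⊗[ℂ] H :=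
  TensorProduct.map LinearMap.id (LinearMap.mul' ℂ H) ∘ₗ
  (TensorProduct.assoc ℂ A H H).toLinearMap ∘ₗ
  TensorProduct.map (smashTau H A) LinearMap.id ∘ₗ
  (TensorProduct.assoc ℂ H A H).symm.toLinearMap

/-- The multiplication of the smash product,
`(μ_A ⊗ μ_H) ∘ (id_A ⊗ τ ⊗ id_H) : (A ⊗ H) ⊗ (A ⊗ H) → A ⊗ H`. -/
def smashMul : (A ⊗[ℂ] H) ⊗[ℂ] (A ⊗[ℂ] H) →ₗ[ℂ] A ⊗[ℂ] H :=
  TensorProduct.map (LinearMap.mul' ℂ A) LinearMap.id ∘ₗ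
  (TensorProduct.assoc ℂ A A H).symm.toLinearMap ∘ₗ
  TensorProduct.map LinearMap.id (smashInner H A) ∘ₗ
  (TensorProduct.assoc ℂ A H (A ⊗[ℂ] H)).toLinearMap

theorem smashMul_apply (t : (A ⊗[ℂ] H) ⊗[ℂ] (A ⊗[ℂ] H)) :
    smashMul H A t =
      TensorProduct.map (LinearMap.mul' ℂ A) LinearMap.id ((TensorProduct.assoc ℂ A A H).symm
        (TensorProduct.map LinearMap.id (smashInner H A)
          (TensorProduct.assoc ℂ A H (A ⊗[ℂ] H) t))) := rfl

variable {H A}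

theorem smashTau_tmul {ι : Type*} (h : H) (a : A) (r : Coalgebra.Repr ℂ h ι) :
    smashTau H A (h ⊗ₜ a) = ∑ i ∈ r.index, (r.left i • a) ⊗ₜ[ℂ] r.right i := by
  simp [smashTau, ← r.eq, TensorProduct.sum_tmul]

theorem smashMul_tmul {ι : Type*} (a b : A) (h k : H) (r : Coalgebra.Repr ℂ h ι) :
    smashMul H A ((a ⊗ₜ h) ⊗ₜ (b ⊗ₜ k)) =
      ∑ i ∈ r.index, (a * r.left i • b) ⊗ₜ[ℂ] (r.right i * k) := by
  simp [smashMul, smashInner, smashTau_tmul h b r, TensorProduct.sum_tmul, TensorProduct.tmul_sum]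

theorem smul_mul_repr [IsModuleAlgebra H A] {ι : Type*} (h : H) (a b : A)
    (r : Coalgebra.Repr ℂ h ι) :
    h • (a * b) = ∑ i ∈ r.index, (r.left i • a) * (r.right i • b) := by
  rw [IsModuleAlgebra.smul_mul h a b, ← r.eq]
  simp

/-- The product of two representations of `Δ h` and `Δ k` represents `Δ (h k)`. -/
def reprMul {ι κ : Type*} {h k : H} (r : Coalgebra.Repr ℂ h ι) (s : Coalgebra.Repr ℂ k κ) :
    Coalgebra.Repr ℂ (h * k) (ι × κ) where
  index := r.index ×ˢ s.index
  left i := r.left i.1 * s.left i.2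
  right i := r.right i.1 * s.right i.2
  eq := by
    rw [Bialgebra.comul_mul, ← r.eq, ← s.eq, Finset.sum_mul_sum, Finset.sum_product]
    simp

/-- The representation `Δ 1 = 1 ⊗ 1`. -/
def reprOne : Coalgebra.Repr ℂ (1 : H) Unit where
  index := {()}
  left _ := 1
  right _ := 1
  eq := by simp [Algebra.TensorProduct.one_def]

theorem smashMul_one_left (x : A ⊗[ℂ] H) : smashMul H A ((1 ⊗ₜ 1) ⊗ₜ x) = x := by
  induction x using TensorProduct.induction_on with
  | zero => simp
  | tmul a h => rw [smashMul_tmul 1 a 1 h reprOne]; simp [reprOne]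
  | add x y hx hy => rw [TensorProduct.tmul_add, map_add, hx, hy]

theorem smashMul_one_right [IsModuleAlgebra H A] (x : A ⊗[ℂ] H) :
    smashMul H A (x ⊗ₜ (1 ⊗ₜ 1)) = x := by
  induction x using TensorProduct.induction_on with
  | zero => simp
  | tmul a h =>
    let r := Coalgebra.Repr.arbitrary ℂ h
    rw [smashMul_tmul a 1 h 1 r]
    simp only [IsModuleAlgebra.smul_one, mul_one]
    simp_rw [← Algebra.commutes, ← Algebra.smul_def, TensorProduct.smul_tmul]
    rw [← TensorProduct.tmul_sum, Coalgebra.sum_counit_smul r]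
  | add x y hx hy => rw [TensorProduct.add_tmul, map_add, hx, hy]

theorem smashMul_assoc [IsModuleAlgebra H A] (x y z : A ⊗[ℂ] H) :
    smashMul H A (smashMul H A (x ⊗ₜ y) ⊗ₜ z) = smashMul H A (x ⊗ₜ smashMul H A (y ⊗ₜ z)) := by
  induction x using TensorProduct.induction_on with
  | zero => simp
  | add x x' hx hx' => simp only [TensorProduct.add_tmul, map_add, hx, hx']
  | tmul a h =>
  induction y using TensorProduct.induction_on with
  | zero => simp
  | add x x' hx hx' => simp only [TensorProduct.add_tmul, TensorProduct.tmul_add, map_add, hx, hx']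
  | tmul b k =>
  induction z using TensorProduct.induction_on with
  | zero => simp
  | add x x' hx hx' => simp only [TensorProduct.tmul_add, map_add, hx, hx']
  | tmul c l =>
    let r := Coalgebra.Repr.arbitrary ℂ h
    let s := Coalgebra.Repr.arbitrary ℂ k
    let r₁ := fun i => Coalgebra.Repr.arbitrary ℂ (r.left i)
    let r₂ := fun i => Coalgebra.Repr.arbitrary ℂ (r.right i)
    rw [smashMul_tmul a b h k r, smashMul_tmul b c k l s, TensorProduct.sum_tmul,
      TensorProduct.tmul_sum, map_sum, map_sum]
    have h1 : ∀ i, smashMul H A ((a * r.left i • b) ⊗ₜ (r.right i * k) ⊗ₜ[ℂ] (c ⊗ₜ l)) =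
        ∑ j ∈ s.index, ∑ m ∈ (r₂ i).index,
          (a * r.left i • b * (((r₂ i).left m * s.left j) • c)) ⊗ₜ[ℂ]
            ((r₂ i).right m * s.right j * l) := by
      intro i
      rw [smashMul_tmul _ _ _ _ (reprMul (r₂ i) s)]
      simp only [reprMul, Finset.sum_product]
      exact Finset.sum_comm
    have h2 : ∀ j, smashMul H A ((a ⊗ₜ h) ⊗ₜ[ℂ] ((b * s.left j • c) ⊗ₜ (s.right j * l))) =
        ∑ i ∈ r.index, ∑ m ∈ (r₁ i).index,
          (a * ((r₁ i).left m • b * (((r₁ i).right m * s.left j) • c))) ⊗ₜ[ℂ]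
            (r.right i * (s.right j * l)) := by
      intro j
      rw [smashMul_tmul _ _ _ _ r]
      refine Finset.sum_congr rfl fun i _ => ?_
      rw [smul_mul_repr (r.left i) b (s.left j • c) (r₁ i), Finset.mul_sum,
        TensorProduct.sum_tmul]
      simp only [mul_smul]
    simp_rw [h1, h2]
    rw [Finset.sum_comm]
    refine Finset.sum_congr rfl fun j _ => ?_
    let Φ : H ⊗[ℂ] (H ⊗[ℂ] H) →ₗ[ℂ] A ⊗[ℂ] H :=
      TensorProduct.map (LinearMap.mulLeft ℂ a ∘ₗ LinearMap.mul' ℂ A)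
          (LinearMap.mulRight ℂ (s.right j * l)) ∘ₗ
        (TensorProduct.assoc ℂ A A H).symm.toLinearMap ∘ₗ
        TensorProduct.map ((actionBilin H A).flip b)
          (TensorProduct.map ((actionBilin H A).flip (s.left j • c)) LinearMap.id)
    have h3 := congrArg Φ (Coalgebra.sum_tmul_tmul_eq r r₁ r₂)
    simp only [map_sum] at h3
    simpa [Φ, mul_smul, mul_assoc] using h3.symm

end Smash

section SmashRing

variable (A H : Type*) [Ring H] [Bialgebra ℂ H] [Ring A] [Algebra ℂ A] [Module H A]
  [IsScalarTower ℂ H A]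

/-- The smash product `A # H`: the vector space `A ⊗ H` with the multiplication
`(a ⊗ h)(a' ⊗ h') = ∑ a (h₍₁₎ • a') ⊗ h₍₂₎ h'`. -/
def SmashProduct : Type _ := A ⊗[ℂ] H

instance : AddCommGroup (SmashProduct A H) := inferInstanceAs (AddCommGroup (A ⊗[ℂ] H))

instance : Module ℂ (SmashProduct A H) := inferInstanceAs (Module ℂ (A ⊗[ℂ] H))

/-- The identity map `A ⊗ H → A # H`. -/
def toSmash : A ⊗[ℂ] H ≃ₗ[ℂ] SmashProduct A H := LinearEquiv.refl ℂ _

instance : Mul (SmashProduct A H) :=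
  ⟨fun x y => toSmash A H (smashMul H A ((toSmash A H).symm x ⊗ₜ (toSmash A H).symm y))⟩

instance : One (SmashProduct A H) := ⟨toSmash A H (1 ⊗ₜ 1)⟩

theorem SmashProduct.mul_def (x y : SmashProduct A H) :
    x * y = toSmash A H (smashMul H A ((toSmash A H).symm x ⊗ₜ (toSmash A H).symm y)) := rfl

theorem SmashProduct.one_def : (1 : SmashProduct A H) = toSmash A H (1 ⊗ₜ 1) := rfl

variable [IsModuleAlgebra H A]

instance : Ring (SmashProduct A H) :=
  { (inferInstance : AddCommGroup (SmashProduct A H)),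
    (inferInstance : Mul (SmashProduct A H)), (inferInstance : One (SmashProduct A H)) with
    left_distrib := fun x y z => by
      simp only [SmashProduct.mul_def, map_add, TensorProduct.tmul_add]
    right_distrib := fun x y z => by
      simp only [SmashProduct.mul_def, map_add, TensorProduct.add_tmul]
    zero_mul := fun x => by simp [SmashProduct.mul_def]
    mul_zero := fun x => by simp [SmashProduct.mul_def]
    mul_assoc := fun x y z => by
      simp only [SmashProduct.mul_def, LinearEquiv.symm_apply_apply, smashMul_assoc]
    one_mul := fun x => by
      simp only [SmashProduct.mul_def, SmashProduct.one_def, LinearEquiv.symm_apply_apply,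
        smashMul_one_left, LinearEquiv.apply_symm_apply]
    mul_one := fun x => by
      simp only [SmashProduct.mul_def, SmashProduct.one_def, LinearEquiv.symm_apply_apply,
        smashMul_one_right, LinearEquiv.apply_symm_apply] }

instance : Algebra ℂ (SmashProduct A H) :=
  Algebra.ofModule
    (fun c x y => by
      simp only [SmashProduct.mul_def, map_smul, ← TensorProduct.smul_tmul'])
    (fun c x y => by
      simp only [SmashProduct.mul_def, map_smul, TensorProduct.tmul_smul])

end SmashRing

/-! ### Arens–Michael envelopes and `H`-completions -/

section Envelope

/-- A seminorm `p` on an algebra is submultiplicative if `p(ab) ≤ p(a) p(b)`. -/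
def IsSubmultiplicative {A : Type*} [Ring A] [Algebra ℂ A] (p : Seminorm ℂ A) : Prop :=
  ∀ a b : A, p (a * b) ≤ p a * p b

/-- A family of submultiplicative seminorms. -/
class IsSubmultFamily {A : Type*} [Ring A] [Algebra ℂ A] (P : Set (Seminorm ℂ A)) : Prop where
  submult : ∀ p ∈ P, IsSubmultiplicative p

section Algebra

variable {A : Type*} [Ring A] [Algebra ℂ A] (P : Set (Seminorm ℂ A))

instance : Ring (SeminormTop P) := inferInstanceAs (Ring A)

instance : Algebra ℂ (SeminormTop P) := inferInstanceAs (Algebra ℂ A)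

instance [IsSubmultFamily P] : IsTopologicalRing (SeminormTop P) where
  continuous_mul := by
    refine continuous_bilin_of_bound (SeminormTop.withSeminorms P)
      (LinearMap.mul ℂ (SeminormTop P)) fun i => ?_
    refine ⟨_, (SeminormTop.withSeminorms P).continuous_seminorm i, _,
      (SeminormTop.withSeminorms P).continuous_seminorm i, fun x y => ?_⟩
    exact IsSubmultFamily.submult i.1 i.2 x y

/-- The canonical homomorphism of the algebra `A` to its completion with respect to a family of
submultiplicative seminorms. -/
def toSeminormCompletion [IsSubmultFamily P] : A →ₐ[ℂ] SeminormCompletion P where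
  toFun a := ((toSeminormTop P a : SeminormTop P) : Completion (SeminormTop P))
  map_one' := Completion.coe_one (SeminormTop P)
  map_mul' a b := Completion.coe_mul (α := SeminormTop P) (toSeminormTop P a) (toSeminormTop P b)
  map_zero' := Completion.coe_zero (α := SeminormTop P)
  map_add' a b := Completion.coe_add (α := SeminormTop P) (toSeminormTop P a) (toSeminormTop P b)
  commutes' _ := rfl

theorem denseRange_toSeminormCompletion [IsSubmultFamily P] :
    DenseRange (toSeminormCompletion P) :=
  Completion.denseRange_coe (α := SeminormTop P)

end Algebra

variable (H A : Type*) [Ring H] [Algebra ℂ H] [Ring A] [Algebra ℂ A]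

/-- The family of all submultiplicative seminorms on `A`. -/
def submultSeminorms : Set (Seminorm ℂ A) := {p | IsSubmultiplicative p}

instance : IsSubmultFamily (submultSeminorms A) := ⟨fun _ hp => hp⟩

/-- The Arens–Michael envelope of `A`: the completion of `A` with respect to the family of all
submultiplicative seminorms. -/
abbrev AMEnvelope : Type _ := SeminormCompletion (submultSeminorms A)

/-- The canonical homomorphism of `A` to its Arens–Michael envelope. -/
abbrev toAMEnvelope : A →ₐ[ℂ] AMEnvelope A := toSeminormCompletion (submultSeminorms A)

/-- A seminorm `p` on an `H`-module `A` is `H`-stable if for each `h : H` there is `C > 0` such that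
`p (h • a) ≤ C p(a)` for all `a`. -/
def IsStable [Module H A] (p : Seminorm ℂ A) : Prop :=
  ∀ h : H, ∃ C > 0, ∀ a : A, p (h • a) ≤ C * p a

/-- The family of all `H`-stable submultiplicative seminorms on `A`. -/
def stableSeminorms [Module H A] : Set (Seminorm ℂ A) :=
  {p | IsStable H A p ∧ IsSubmultiplicative p}

instance [Module H A] : IsSubmultFamily (stableSeminorms H A) := ⟨fun _ hp => hp.2⟩

/-- The `H`-completion of `A`: the completion of `A` with respect to the family of all `H`-stable
submultiplicative seminorms. -/
abbrev HCompletion [Module H A] : Type _ := SeminormCompletion (stableSeminorms H A)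

/-- The canonical homomorphism of `A` to its `H`-completion. -/
abbrev toHCompletion [Module H A] : A →ₐ[ℂ] HCompletion H A :=
  toSeminormCompletion (stableSeminorms H A)

/-- The multiplication of a completion, as a continuous linear map `B ⊗̂ B → B`. -/
def completionMul {A : Type*} [Ring A] [Algebra ℂ A] (P : Set (Seminorm ℂ A))
    [IsSubmultFamily P] :
    CProj (SeminormCompletion P) (SeminormCompletion P) →L[ℂ] SeminormCompletion P :=
  CProj.lift (LinearMap.mul ℂ (SeminormCompletion P)) continuous_mul

end Envelope

/-! ### The comultiplication of the Arens–Michael envelope -/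

section Comul

variable (H : Type*) [Ring H] [Bialgebra ℂ H]

theorem IsSubmultiplicative.proj {A B : Type*} [Ring A] [Algebra ℂ A] [Ring B] [Algebra ℂ B]
    {p : Seminorm ℂ A} {q : Seminorm ℂ B}
    (hp : IsSubmultiplicative p) (hq : IsSubmultiplicative q) :
    IsSubmultiplicative (projSeminorm p q) := by
  have h1 : ∀ (u : A ⊗[ℂ] B) (x : A) (y : B),
      projSeminorm p q (u * (x ⊗ₜ y)) ≤ (p x * q y) * projSeminorm p q u := by
    intro u x y
    refine le_projSeminorm p q ((projSeminorm p q).comp (LinearMap.mulRight ℂ (x ⊗ₜ[ℂ] y)))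
      (mul_nonneg (apply_nonneg p x) (apply_nonneg q y)) (fun x' y' => ?_) u
    simp only [Seminorm.comp_apply, LinearMap.mulRight_apply, Algebra.TensorProduct.tmul_mul_tmul]
    refine (projSeminorm_tmul_le p q _ _).trans ?_
    refine (mul_le_mul (hp _ _) (hq _ _) (apply_nonneg q _)
      (mul_nonneg (apply_nonneg p _) (apply_nonneg p _))).trans (le_of_eq ?_)
    ring
  intro u v
  refine le_projSeminorm p q ((projSeminorm p q).comp (LinearMap.mulLeft ℂ u))
      (apply_nonneg _ u) (fun x y => ?_) v
  rw [mul_comm]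
  exact h1 u x y

theorem IsSubmultiplicative.sup {A : Type*} [Ring A] [Algebra ℂ A] {p q : Seminorm ℂ A}
    (hp : IsSubmultiplicative p) (hq : IsSubmultiplicative q) : IsSubmultiplicative (p ⊔ q) := by
  intro a b
  simp only [Seminorm.sup_apply]
  refine max_le ((hp a b).trans ?_) ((hq a b).trans ?_)
  · exact mul_le_mul (le_max_left _ _) (le_max_left _ _) (apply_nonneg p b)
      ((apply_nonneg p a).trans (le_max_left _ _))
  · exact mul_le_mul (le_max_right _ _) (le_max_right _ _) (apply_nonneg q b)
      ((apply_nonneg p a).trans (le_max_left _ _))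

theorem IsSubmultiplicative.finset_sup {A : Type*} [Ring A] [Algebra ℂ A] {ι : Type*}
    (p : ι → Seminorm ℂ A) (hp : ∀ i, IsSubmultiplicative (p i)) (s : Finset ι) :
    IsSubmultiplicative (s.sup p) := by
  refine Finset.sup_induction ?_ (fun _ h _ h' => h.sup h') fun i _ => hp i
  intro a b
  simp

theorem IsSubmultiplicative.smul {A : Type*} [Ring A] [Algebra ℂ A] {p : Seminorm ℂ A}
    (hp : IsSubmultiplicative p) {C : ℝ≥0} (hC : 1 ≤ C) : IsSubmultiplicative (C • p) := by
  intro a b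
  have hC' : (1 : ℝ) ≤ C := hC
  have h1 : 0 ≤ p a * p b := mul_nonneg (apply_nonneg p a) (apply_nonneg p b)
  simp only [smul_apply, NNReal.smul_def, smul_eq_mul]
  calc (C : ℝ) * p (a * b) ≤ C * (p a * p b) :=
        mul_le_mul_of_nonneg_left (hp a b) (by linarith)
    _ ≤ C * (C * (p a * p b)) :=
        mul_le_mul_of_nonneg_left (le_mul_of_one_le_left h1 hC') (by linarith)
    _ = C * p a * (C * p b) := by ring

/-- Each continuous seminorm on the Arens–Michael envelope is dominated on `A` by a
submultiplicative seminorm. -/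
theorem exists_submult_le {A : Type*} [Ring A] [Algebra ℂ A] {r : Seminorm ℂ (AMEnvelope A)}
    (hr : Continuous r) :
    ∃ p : Seminorm ℂ A, IsSubmultiplicative p ∧ ∀ a, r (embed (submultSeminorms A) a) ≤ p a := by
  obtain ⟨s, C, -, h⟩ := Seminorm.bound_of_continuous
    (SeminormTop.withSeminorms (submultSeminorms A))
    (r.comp (toComplL (SeminormTop (submultSeminorms A))).toLinearMap)
    (hr.comp (toComplL (SeminormTop (submultSeminorms A))).continuous)
  have hs : IsSubmultiplicative (A := SeminormTop (submultSeminorms A))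
      (s.sup (SeminormTop.seminorm (submultSeminorms A))) :=
    IsSubmultiplicative.finset_sup _ (fun i => i.2) s
  have hs' := hs.smul (le_max_left 1 C)
  refine ⟨((max 1 C) • s.sup (SeminormTop.seminorm (submultSeminorms A))).comp
    (toSeminormTop (submultSeminorms A)).toLinearMap, fun a b => hs' _ _, fun a => ?_⟩
  refine (h (toSeminormTop (submultSeminorms A) a)).trans ?_
  simp only [Seminorm.comp_apply, smul_apply, NNReal.smul_def, smul_eq_mul]
  exact mul_le_mul_of_nonneg_right (by exact_mod_cast le_max_right _ _) (apply_nonneg _ _)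

section jmap

variable {X Y Z E F G E' F' : Type*} [AddCommGroup X] [Module ℂ X] [AddCommGroup Y] [Module ℂ Y]
  [AddCommGroup Z] [Module ℂ Z]
  [AddCommGroup E] [Module ℂ E] [UniformSpace E] [IsUniformAddGroup E]
  [UniformContinuousConstSMul ℂ E] [PolynormableSpace ℂ E]
  [AddCommGroup F] [Module ℂ F] [UniformSpace F] [IsUniformAddGroup F]
  [UniformContinuousConstSMul ℂ F] [PolynormableSpace ℂ F]
  [AddCommGroup G] [Module ℂ G] [UniformSpace G] [IsUniformAddGroup G]
  [UniformContinuousConstSMul ℂ G] [PolynormableSpace ℂ G]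
  [AddCommGroup E'] [Module ℂ E'] [UniformSpace E'] [IsUniformAddGroup E']
  [UniformContinuousConstSMul ℂ E'] [PolynormableSpace ℂ E']
  [AddCommGroup F'] [Module ℂ F'] [UniformSpace F'] [IsUniformAddGroup F']
  [UniformContinuousConstSMul ℂ F'] [PolynormableSpace ℂ F']

/-- The map `X ⊗ Y → E ⊗̂ F`, `x ⊗ y ↦ f(x) ⊗ g(y)`. -/
def jmap (f : X →ₗ[ℂ] E) (g : Y →ₗ[ℂ] F) : X ⊗[ℂ] Y →ₗ[ℂ] CProj E F :=
  toCProj E F ∘ₗ TensorProduct.map f g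

@[simp]
theorem jmap_tmul (f : X →ₗ[ℂ] E) (g : Y →ₗ[ℂ] F) (x : X) (y : Y) :
    jmap f g (x ⊗ₜ y) = ctmul E F (f x) (g y) := rfl

theorem map_jmap {X' Y' : Type*} [AddCommGroup X'] [Module ℂ X'] [AddCommGroup Y'] [Module ℂ Y']
    {f : X →ₗ[ℂ] E} {g : Y →ₗ[ℂ] F} {φ : E →L[ℂ] E'} {ψ : F →L[ℂ] F'}
    {f' : X' →ₗ[ℂ] E'} {g' : Y' →ₗ[ℂ] F'} {u : X →ₗ[ℂ] X'} {v : Y →ₗ[ℂ] Y'}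
    (hφ : ∀ x, φ (f x) = f' (u x)) (hψ : ∀ y, ψ (g y) = g' (v y)) (t : X ⊗[ℂ] Y) :
    CProj.map φ ψ (jmap f g t) = jmap f' g' (TensorProduct.map u v t) := by
  induction t using TensorProduct.induction_on with
  | zero => simp
  | tmul x y => simp [hφ, hψ]
  | add x y hx hy => simp only [map_add, hx, hy]

theorem map_id_jmap {Y' : Type*} [AddCommGroup Y'] [Module ℂ Y']
    (f : X →ₗ[ℂ] E) (g : Y →ₗ[ℂ] F) (ψ : F →L[ℂ] F') (g' : Y' →ₗ[ℂ] F') (v : Y →ₗ[ℂ] Y')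
    (hψ : ∀ y, ψ (g y) = g' (v y)) (t : X ⊗[ℂ] Y) :
    CProj.map (ContinuousLinearMap.id ℂ E) ψ (jmap f g t) =
      jmap f g' (TensorProduct.map LinearMap.id v t) :=
  map_jmap (f := f) (f' := f) (u := LinearMap.id) (fun _ => rfl) hψ t

theorem map_jmap_id {X' : Type*} [AddCommGroup X'] [Module ℂ X']
    (f : X →ₗ[ℂ] E) (g : Y →ₗ[ℂ] F) (φ : E →L[ℂ] E') (f' : X' →ₗ[ℂ] E') (u : X →ₗ[ℂ] X')
    (hφ : ∀ x, φ (f x) = f' (u x)) (t : X ⊗[ℂ] Y) :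
    CProj.map φ (ContinuousLinearMap.id ℂ F) (jmap f g t) =
      jmap f' g (TensorProduct.map u LinearMap.id t) :=
  map_jmap (g := g) (g' := g) (v := LinearMap.id) hφ (fun _ => rfl) t

theorem comm_jmap (f : X →ₗ[ℂ] E) (g : Y →ₗ[ℂ] F) (t : X ⊗[ℂ] Y) :
    CProj.comm E F (jmap f g t) = jmap g f (TensorProduct.comm ℂ X Y t) := by
  induction t using TensorProduct.induction_on with
  | zero => simp
  | tmul x y => simp
  | add x y hx hy => simp only [map_add, hx, hy]

theorem assoc_jmap (f : X →ₗ[ℂ] E) (g : Y →ₗ[ℂ] F) (k : Z →ₗ[ℂ] G) (t : (X ⊗[ℂ] Y) ⊗[ℂ] Z) :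
    CProj.assoc E F G (jmap (jmap f g) k t) =
      jmap f (jmap g k) (TensorProduct.assoc ℂ X Y Z t) := by
  induction t using TensorProduct.induction_on with
  | zero => simp
  | add x y hx hy => simp only [map_add, hx, hy]
  | tmul t z =>
    induction t using TensorProduct.induction_on with
    | zero => simp
    | tmul x y => simp
    | add x y hx hy => simp only [map_add, TensorProduct.add_tmul, hx, hy]

theorem assocInv_jmap (f : X →ₗ[ℂ] E) (g : Y →ₗ[ℂ] F) (k : Z →ₗ[ℂ] G)
    (t : X ⊗[ℂ] (Y ⊗[ℂ] Z)) :
    CProj.assocInv E F G (jmap f (jmap g k) t) =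
      jmap (jmap f g) k ((TensorProduct.assoc ℂ X Y Z).symm t) := by
  induction t using TensorProduct.induction_on with
  | zero => simp
  | add x y hx hy => simp only [map_add, hx, hy]
  | tmul x t =>
    induction t using TensorProduct.induction_on with
    | zero => simp
    | tmul x y => simp
    | add x y hx hy => simp only [map_add, TensorProduct.tmul_add, hx, hy]

theorem denseRange_jmap (f : X →ₗ[ℂ] E) (g : Y →ₗ[ℂ] F) (hf : DenseRange f) (hg : DenseRange g) :
    DenseRange (jmap f g) := by
  have h1 : ∀ x y, ctmul E F x y ∈ (LinearMap.range (jmap f g)).topologicalClosure := by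
    intro x y
    have hm : Set.MapsTo (fun z : E × F => ctmul E F z.1 z.2) (Set.range (Prod.map f g))
        (LinearMap.range (jmap f g)) := by
      rintro _ ⟨⟨a, b⟩, rfl⟩
      exact ⟨a ⊗ₜ b, rfl⟩
    have := map_mem_closure (continuous_ctmul (E := E) (F := F)) (hf.prodMap hg (x, y)) hm
    exact this
  have h2 : ∀ u, toCProj E F u ∈ (LinearMap.range (jmap f g)).topologicalClosure := by
    intro u
    induction u using TensorProduct.induction_on with
    | zero => rw [map_zero]; exact zero_mem _
    | tmul x y => exact h1 x y
    | add x y hx hy => rw [map_add]; exact add_mem hx hy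
  have h3 : Dense (closure (Set.range (jmap f g))) :=
    (denseRange_toCProj (E := E) (F := F)).mono (by rintro _ ⟨u, rfl⟩; exact h2 u)
  exact dense_closure.1 h3

end jmap

/-- The map `H → Ĥ ⊗̂ Ĥ` induced by the comultiplication of `H`. -/
def comulAux : SeminormTop (submultSeminorms H) →ₗ[ℂ] CProj (AMEnvelope H) (AMEnvelope H) :=
  jmap (embed (submultSeminorms H)) (embed (submultSeminorms H)) ∘ₗ
    Coalgebra.comul (R := ℂ) ∘ₗ (toSeminormTop (submultSeminorms H)).symm.toLinearMap

theorem continuous_comulAux : Continuous (comulAux H) := by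
  refine (PolynormableSpace.withSeminorms ℂ
    (CProj (AMEnvelope H) (AMEnvelope H))).continuous_of_continuous_comp _ ?_
  rintro ⟨r, hr⟩
  obtain ⟨p, hp, q, hq, h⟩ := exists_bound_of_continuous_bilin
    (ctmul (AMEnvelope H) (AMEnvelope H)) continuous_ctmul hr
  obtain ⟨p', hp', hpp'⟩ := exists_submult_le hp
  obtain ⟨q', hq', hqq'⟩ := exists_submult_le hq
  have hs : (projSeminorm p' q').comp (Coalgebra.comul (R := ℂ)) ∈ submultSeminorms H := by
    intro a b
    simp only [Seminorm.comp_apply, Bialgebra.comul_mul]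
    exact hp'.proj hq' _ _
  refine Seminorm.continuous_of_le
    ((SeminormTop.withSeminorms (submultSeminorms H)).continuous_seminorm ⟨_, hs⟩) fun x => ?_
  have := le_projSeminorm p' q'
    (r.comp (jmap (embed (submultSeminorms H)) (embed (submultSeminorms H)))) zero_le_one
    (fun x y => by
      rw [one_mul]
      exact (h _ _).trans (mul_le_mul (hpp' x) (hqq' y) (apply_nonneg q _) (apply_nonneg p' _)))
    (Coalgebra.comul (R := ℂ) ((toSeminormTop (submultSeminorms H)).symm x))
  rw [one_mul] at this
  exact this

/-- The comultiplication `Ĥ → Ĥ ⊗̂ Ĥ` of the Arens–Michael envelope: the continuous extension of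
the comultiplication of `H`. -/
def comulHat : AMEnvelope H →L[ℂ] CProj (AMEnvelope H) (AMEnvelope H) :=
  ContinuousLinearMap.fromCompletion ⟨comulAux H, continuous_comulAux H⟩

theorem comulHat_coe (h : H) : comulHat H (embed (submultSeminorms H) h) =
    jmap (embed (submultSeminorms H)) (embed (submultSeminorms H))
      (Coalgebra.comul (R := ℂ) h) :=
  ContinuousLinearMap.fromCompletion_apply_coe _ (toSeminormTop (submultSeminorms H) h)

end Comul

/-! ### The action of `Ĥ` on the `H`-completion -/

section Action

variable {H A : Type*} [Ring H] [Algebra ℂ H] [Ring A] [Algebra ℂ A] [Module H A]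
  [IsScalarTower ℂ H A]

/-- The admissible operator bounds of `h : H` with respect to the seminorm `p`. -/
def opBounds (p : Seminorm ℂ A) (h : H) : Set ℝ := {C | 0 ≤ C ∧ ∀ a : A, p (h • a) ≤ C * p a}

theorem opBounds_bddBelow (p : Seminorm ℂ A) (h : H) : BddBelow (opBounds p h) :=
  ⟨0, fun _ hC => hC.1⟩

theorem opBounds_nonempty {p : Seminorm ℂ A} (hp : IsStable H A p) (h : H) :
    (opBounds p h).Nonempty := by
  obtain ⟨C, hC, hC'⟩ := hp h
  exact ⟨C, hC.le, hC'⟩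

theorem opBounds_sInf_nonneg (p : Seminorm ℂ A) (h : H) : 0 ≤ sInf (opBounds p h) :=
  Real.sInf_nonneg fun _ hC => hC.1

theorem le_opBounds_sInf {p : Seminorm ℂ A} (hp : IsStable H A p) (h : H) (a : A) :
    p (h • a) ≤ sInf (opBounds p h) * p a := by
  rcases (apply_nonneg p a).eq_or_lt with ha | ha
  · obtain ⟨C, -, hC⟩ := opBounds_nonempty hp h
    have := hC a
    rw [← ha, mul_zero] at this ⊢
    exact this
  · rw [← div_le_iff₀ ha]
    refine le_csInf (opBounds_nonempty hp h) fun C hC => ?_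
    rw [div_le_iff₀ ha]
    exact hC.2 a

/-- The operator seminorm on `H` induced by an `H`-stable seminorm on `A`. -/
def opSeminorm (p : Seminorm ℂ A) (hp : IsStable H A p) : Seminorm ℂ H :=
  Seminorm.ofSMulLE (fun h => sInf (opBounds p h))
    (le_antisymm (csInf_le (opBounds_bddBelow p 0) ⟨le_rfl, fun a => by simp⟩)
      (opBounds_sInf_nonneg p 0))
    (fun h k => csInf_le (opBounds_bddBelow p _)
      ⟨add_nonneg (opBounds_sInf_nonneg p h) (opBounds_sInf_nonneg p k), fun a => by
        rw [add_smul, add_mul]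
        exact (map_add_le_add p _ _).trans
          (add_le_add (le_opBounds_sInf hp h a) (le_opBounds_sInf hp k a))⟩)
    (fun c h => csInf_le (opBounds_bddBelow p _)
      ⟨mul_nonneg (norm_nonneg c) (opBounds_sInf_nonneg p h), fun a => by
        rw [smul_assoc, map_smul_eq_mul, mul_assoc]
        exact mul_le_mul_of_nonneg_left (le_opBounds_sInf hp h a) (norm_nonneg c)⟩)

theorem opSeminorm_submult (p : Seminorm ℂ A) (hp : IsStable H A p) :
    IsSubmultiplicative (opSeminorm p hp) := fun h k =>
  csInf_le (opBounds_bddBelow p _)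
    ⟨mul_nonneg (opBounds_sInf_nonneg p h) (opBounds_sInf_nonneg p k), fun a => by
      rw [mul_smul, mul_assoc]
      exact (le_opBounds_sInf hp h _).trans
        (mul_le_mul_of_nonneg_left (le_opBounds_sInf hp k a) (opBounds_sInf_nonneg p h))⟩

end Action

section ActionHat

variable (H A : Type*) [Ring H] [Bialgebra ℂ H] [Ring A] [Algebra ℂ A] [Module H A]
  [IsScalarTower ℂ H A]

/-- The action of `H` on `A`, with values in the `H`-completion of `A`. -/
def actionAux : SeminormTop (submultSeminorms H) →ₗ[ℂ] SeminormTop (stableSeminorms H A) →ₗ[ℂ]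
    HCompletion H A :=
  ((actionBilin H A).compl₁₂ (toSeminormTop (submultSeminorms H)).symm.toLinearMap
    (toSeminormTop (stableSeminorms H A)).symm.toLinearMap).compr₂
    (embed (stableSeminorms H A))

theorem continuous_actionAux : Continuous
    fun z : SeminormTop (submultSeminorms H) × SeminormTop (stableSeminorms H A) =>
      actionAux H A z.1 z.2 := by
  have h : Continuous
      fun z : SeminormTop (submultSeminorms H) × SeminormTop (stableSeminorms H A) =>
      (((actionBilin H A).compl₁₂ (toSeminormTop (submultSeminorms H)).symm.toLinearMap
        (toSeminormTop (stableSeminorms H A)).symm.toLinearMap).compr₂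
        (toSeminormTop (stableSeminorms H A)).toLinearMap) z.1 z.2 := by
    refine continuous_bilin_of_bound (SeminormTop.withSeminorms (stableSeminorms H A)) _ ?_
    rintro ⟨p, hp⟩
    refine ⟨_, (SeminormTop.withSeminorms (submultSeminorms H)).continuous_seminorm
      ⟨opSeminorm p hp.1, opSeminorm_submult p hp.1⟩, _,
      (SeminormTop.withSeminorms (stableSeminorms H A)).continuous_seminorm ⟨p, hp⟩,
      fun h a => le_opBounds_sInf hp.1 _ _⟩
  exact (Completion.continuous_coe (SeminormTop (stableSeminorms H A))).comp h

/-- The action `Ĥ ⊗̂ Ã → Ã`: the continuous extension of the action of `H` on `A`. -/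
def actionHat : CProj (AMEnvelope H) (HCompletion H A) →L[ℂ] HCompletion H A :=
  CProj.lift (extendBilin (actionAux H A) (continuous_actionAux H A))
    (continuous_extendBilin (actionAux H A) (continuous_actionAux H A))

theorem actionHat_coe (h : H) (a : A) :
    actionHat H A (ctmul _ _ (embed (submultSeminorms H) h) (embed (stableSeminorms H A) a)) =
      embed (stableSeminorms H A) (h • a) :=
  (CProj.lift_ctmul _ _ _ _).trans
    (extendBilin_coe (actionAux H A) (continuous_actionAux H A)
      (toSeminormTop (submultSeminorms H) h) (toSeminormTop (stableSeminorms H A) a))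

end ActionHat

/-! ### The analytic smash product -/

section BilinOf

variable {E : Type*} [AddCommGroup E] [Module ℂ E] [UniformSpace E] [IsUniformAddGroup E]
  [UniformContinuousConstSMul ℂ E] [PolynormableSpace ℂ E]

/-- The bilinear map `E × E → E` that corresponds to a continuous linear map `E ⊗̂ E → E`. -/
def bilinOf (m : CProj E E →L[ℂ] E) : E →ₗ[ℂ] E →ₗ[ℂ] E := (ctmul E E).compr₂ m.toLinearMap

theorem bilinOf_apply (m : CProj E E →L[ℂ] E) (x y : E) : bilinOf m x y = m (ctmul E E x y) := rfl

theorem continuous_bilinOf (m : CProj E E →L[ℂ] E) :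
    Continuous fun z : E × E => bilinOf m z.1 z.2 :=
  m.continuous.comp continuous_ctmul

end BilinOf

section AnalyticSmashMul

variable {A H : Type*}
  [AddCommGroup H] [Module ℂ H] [UniformSpace H] [IsUniformAddGroup H]
  [UniformContinuousConstSMul ℂ H] [PolynormableSpace ℂ H]
  [AddCommGroup A] [Module ℂ A] [UniformSpace A] [IsUniformAddGroup A]
  [UniformContinuousConstSMul ℂ A] [PolynormableSpace ℂ A]

/-- The map `τ : H ⊗̂ A → A ⊗̂ H` given by a comultiplication `Δ` and an action `act`, as the
composition `H ⊗̂ A → (H ⊗̂ H) ⊗̂ A → H ⊗̂ (H ⊗̂ A) → H ⊗̂ (A ⊗̂ H) → (H ⊗̂ A) ⊗̂ H → A ⊗̂ H`. -/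
def analyticTau (Δ : H →L[ℂ] CProj H H) (act : CProj H A →L[ℂ] A) : CProj H A →L[ℂ] CProj A H :=
  CProj.map act (ContinuousLinearMap.id ℂ H) ∘L
  CProj.assocInv H A H ∘L
  CProj.map (ContinuousLinearMap.id ℂ H) (CProj.comm H A) ∘L
  CProj.assoc H H A ∘L
  CProj.map Δ (ContinuousLinearMap.id ℂ A)

/-- The map `id ⊗̂ μ_H` preceded by `τ ⊗̂ id`: `H ⊗̂ (A ⊗̂ H) → A ⊗̂ H`. -/
def analyticInner (Δ : H →L[ℂ] CProj H H) (μH : CProj H H →L[ℂ] H) (act : CProj H A →L[ℂ] A) :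
    CProj H (CProj A H) →L[ℂ] CProj A H :=
  CProj.map (ContinuousLinearMap.id ℂ A) μH ∘L
  CProj.assoc A H H ∘L
  CProj.map (analyticTau Δ act) (ContinuousLinearMap.id ℂ H) ∘L
  CProj.assocInv H A H

/-- The multiplication of the analytic smash product,
`(μ_A ⊗̂ μ_H) ∘ (id_A ⊗̂ τ ⊗̂ id_H) : (A ⊗̂ H) ⊗̂ (A ⊗̂ H) → A ⊗̂ H`. -/
def analyticSmashMul (Δ : H →L[ℂ] CProj H H) (μH : CProj H H →L[ℂ] H) (μA : CProj A A →L[ℂ] A)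
    (act : CProj H A →L[ℂ] A) : CProj (CProj A H) (CProj A H) →L[ℂ] CProj A H :=
  CProj.map μA (ContinuousLinearMap.id ℂ H) ∘L
  CProj.assocInv A A H ∘L
  CProj.map (ContinuousLinearMap.id ℂ A) (analyticInner Δ μH act) ∘L
  CProj.assoc A H (CProj A H)

theorem analyticSmashMul_jmap {X Y : Type*} [AddCommGroup X] [Module ℂ X] [AddCommGroup Y]
    [Module ℂ Y] (Δ : H →L[ℂ] CProj H H) (μH : CProj H H →L[ℂ] H) (μA : CProj A A →L[ℂ] A)
    (act : CProj H A →L[ℂ] A) (f : X →ₗ[ℂ] A) (g : Y →ₗ[ℂ] H) (mA : X ⊗[ℂ] X →ₗ[ℂ] X)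
    (inner : Y ⊗[ℂ] (X ⊗[ℂ] Y) →ₗ[ℂ] X ⊗[ℂ] Y)
    (hA : ∀ t, μA (jmap f f t) = f (mA t))
    (hi : ∀ t, analyticInner Δ μH act (jmap g (jmap f g) t) = jmap f g (inner t))
    (t : (X ⊗[ℂ] Y) ⊗[ℂ] (X ⊗[ℂ] Y)) :
    analyticSmashMul Δ μH μA act (jmap (jmap f g) (jmap f g) t) =
      jmap f g (TensorProduct.map mA LinearMap.id ((TensorProduct.assoc ℂ X X Y).symm
        (TensorProduct.map LinearMap.id inner (TensorProduct.assoc ℂ X Y (X ⊗[ℂ] Y) t)))) := by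
  simp only [analyticSmashMul, ContinuousLinearMap.comp_apply]
  rw [assoc_jmap f g (jmap f g) t, map_id_jmap f _ (analyticInner Δ μH act) (jmap f g) inner hi,
    assocInv_jmap, map_jmap_id _ _ μA f mA hA]

end AnalyticSmashMul

section AnalyticSmash

variable (A H : Type*) [Ring H] [Bialgebra ℂ H] [Ring A] [Algebra ℂ A] [Module H A]
  [IsScalarTower ℂ H A]

/-- The map `A ⊗ H → Ã ⊗̂ Ĥ`. -/
def toHatTensor : A ⊗[ℂ] H →ₗ[ℂ] CProj (HCompletion H A) (AMEnvelope H) :=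
  jmap (embed (stableSeminorms H A)) (embed (submultSeminorms H))

theorem denseRange_toHatTensor : DenseRange (toHatTensor A H) :=
  denseRange_jmap _ _ (denseRange_embed _) (denseRange_embed _)

variable {H} in
theorem completionMul_jmap (P : Set (Seminorm ℂ A)) [IsSubmultFamily P] (t : A ⊗[ℂ] A) :
    completionMul P (jmap (embed P)
      (embed P) t) =
      embed P (LinearMap.mul' ℂ A t) := by
  induction t using TensorProduct.induction_on with
  | zero => simp
  | add x y hx hy => simp only [map_add, hx, hy]
  | tmul a b =>
    refine (CProj.lift_ctmul _ _ _ _).trans ?_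
    exact (Completion.coe_mul (α := SeminormTop P) (toSeminormTop P a) (toSeminormTop P b)).symm

theorem actionHat_jmap (t : H ⊗[ℂ] A) :
    actionHat H A (jmap (embed (submultSeminorms H)) (embed (stableSeminorms H A)) t) =
      embed (stableSeminorms H A) (TensorProduct.lift (actionBilin H A) t) := by
  induction t using TensorProduct.induction_on with
  | zero => simp
  | add x y hx hy => simp only [map_add, hx, hy]
  | tmul h a => exact actionHat_coe H A h a

theorem analyticTau_jmap (t : H ⊗[ℂ] A) :
    analyticTau (comulHat H) (actionHat H A)
      (jmap (embed (submultSeminorms H)) (embed (stableSeminorms H A)) t) =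
      toHatTensor A H (smashTau H A t) := by
  simp only [analyticTau, smashTau, ContinuousLinearMap.comp_apply, LinearMap.comp_apply,
    LinearEquiv.coe_coe]
  rw [map_jmap_id _ _ (comulHat H)
      (jmap (embed (submultSeminorms H)) (embed (submultSeminorms H))) (Coalgebra.comul (R := ℂ))
      (comulHat_coe H), assoc_jmap,
    map_id_jmap _ _ (CProj.comm (AMEnvelope H) (HCompletion H A))
      (jmap (embed (stableSeminorms H A)) (embed (submultSeminorms H)))
      (TensorProduct.comm ℂ H A).toLinearMap (fun t => comm_jmap _ _ t), assocInv_jmap,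
    map_jmap_id _ _ (actionHat H A) (embed (stableSeminorms H A))
      (TensorProduct.lift (actionBilin H A)) (actionHat_jmap A H)]
  rfl

theorem analyticInner_jmap (t : H ⊗[ℂ] (A ⊗[ℂ] H)) :
    analyticInner (comulHat H) (completionMul (submultSeminorms H)) (actionHat H A)
      (jmap (embed (submultSeminorms H))
        (jmap (embed (stableSeminorms H A)) (embed (submultSeminorms H))) t) =
      jmap (embed (stableSeminorms H A)) (embed (submultSeminorms H)) (smashInner H A t) := by
  simp only [analyticInner, smashInner, ContinuousLinearMap.comp_apply, LinearMap.comp_apply,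
    LinearEquiv.coe_coe]
  rw [assocInv_jmap,
    map_jmap_id _ _ (analyticTau (comulHat H) (actionHat H A))
      (jmap (embed (stableSeminorms H A)) (embed (submultSeminorms H))) (smashTau H A)
      (analyticTau_jmap A H), assoc_jmap,
    map_id_jmap _ _ (completionMul (submultSeminorms H)) (embed (submultSeminorms H))
      (LinearMap.mul' ℂ H) (completionMul_jmap H (submultSeminorms H))]

theorem hatMul_jmap (t : (A ⊗[ℂ] H) ⊗[ℂ] (A ⊗[ℂ] H)) :
    analyticSmashMul (comulHat H) (completionMul (submultSeminorms H))
        (completionMul (stableSeminorms H A)) (actionHat H A)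
        (jmap (jmap (embed (stableSeminorms H A)) (embed (submultSeminorms H)))
          (jmap (embed (stableSeminorms H A)) (embed (submultSeminorms H))) t) =
      jmap (embed (stableSeminorms H A)) (embed (submultSeminorms H)) (smashMul H A t) :=
  analyticSmashMul_jmap (comulHat H) (completionMul (submultSeminorms H))
    (completionMul (stableSeminorms H A)) (actionHat H A) (embed (stableSeminorms H A))
    (embed (submultSeminorms H)) (LinearMap.mul' ℂ A) (smashInner H A)
    (completionMul_jmap A (stableSeminorms H A)) (analyticInner_jmap A H) t

/-- The multiplication of `Ã #̂ Ĥ`, as a continuous linear map. -/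
def hatMul : CProj (CProj (HCompletion H A) (AMEnvelope H))
    (CProj (HCompletion H A) (AMEnvelope H)) →L[ℂ] CProj (HCompletion H A) (AMEnvelope H) :=
  analyticSmashMul (comulHat H) (completionMul (submultSeminorms H))
    (completionMul (stableSeminorms H A)) (actionHat H A)

theorem hatMul_def : hatMul A H = analyticSmashMul (comulHat H)
    (completionMul (submultSeminorms H)) (completionMul (stableSeminorms H A))
    (actionHat H A) := rfl

theorem hatMul_coe (x y : A ⊗[ℂ] H) :
    hatMul A H (ctmul _ _ (toHatTensor A H x) (toHatTensor A H y)) =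
      toHatTensor A H (smashMul H A (x ⊗ₜ y)) :=
  (DFunLike.congr_fun (hatMul_def A H) _).trans (hatMul_jmap A H (x ⊗ₜ y))

/-- The analytic smash product `Ã #̂ Ĥ` of the `H`-completion of `A` and the Arens–Michael envelope
of `H`: the completed projective tensor product `Ã ⊗̂ Ĥ` with the multiplication
`(μ ⊗̂ μ) ∘ (id ⊗̂ τ ⊗̂ id)`. -/
def AnalyticSmash : Type _ := CProj (HCompletion H A) (AMEnvelope H)

instance : AddCommGroup (AnalyticSmash A H) :=
  inferInstanceAs (AddCommGroup (CProj (HCompletion H A) (AMEnvelope H)))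

instance : Module ℂ (AnalyticSmash A H) :=
  inferInstanceAs (Module ℂ (CProj (HCompletion H A) (AMEnvelope H)))

instance : UniformSpace (AnalyticSmash A H) :=
  inferInstanceAs (UniformSpace (CProj (HCompletion H A) (AMEnvelope H)))

instance : IsUniformAddGroup (AnalyticSmash A H) :=
  inferInstanceAs (IsUniformAddGroup (CProj (HCompletion H A) (AMEnvelope H)))

instance : CompleteSpace (AnalyticSmash A H) :=
  inferInstanceAs (CompleteSpace (CProj (HCompletion H A) (AMEnvelope H)))

instance : T0Space (AnalyticSmash A H) :=
  inferInstanceAs (T0Space (CProj (HCompletion H A) (AMEnvelope H)))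

instance : ContinuousSMul ℂ (AnalyticSmash A H) :=
  inferInstanceAs (ContinuousSMul ℂ (CProj (HCompletion H A) (AMEnvelope H)))

instance : PolynormableSpace ℂ (AnalyticSmash A H) :=
  inferInstanceAs (PolynormableSpace ℂ (CProj (HCompletion H A) (AMEnvelope H)))

/-- The multiplication of `Ã #̂ Ĥ` as a bilinear map. -/
def analyticMulBilin : AnalyticSmash A H →ₗ[ℂ] AnalyticSmash A H →ₗ[ℂ] AnalyticSmash A H :=
  bilinOf (hatMul A H)

theorem continuous_analyticMulBilin :
    Continuous fun z : AnalyticSmash A H × AnalyticSmash A H => analyticMulBilin A H z.1 z.2 :=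
  continuous_bilinOf (hatMul A H)

/-- The canonical map `A # H → Ã #̂ Ĥ`, `a ⊗ h ↦ a ⊗ h`, as a linear map. -/
def smashToAnalyticLinear : SmashProduct A H →ₗ[ℂ] AnalyticSmash A H :=
  toHatTensor A H ∘ₗ (toSmash A H).symm.toLinearMap

theorem denseRange_smashToAnalyticLinear : DenseRange (smashToAnalyticLinear A H) :=
  denseRange_toHatTensor A H

theorem analyticMulBilin_coe (x y : SmashProduct A H) :
    analyticMulBilin A H (smashToAnalyticLinear A H x) (smashToAnalyticLinear A H y) =
      smashToAnalyticLinear A H (x * y) :=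
  (bilinOf_apply (hatMul A H) _ _).trans
    (hatMul_coe A H ((toSmash A H).symm x) ((toSmash A H).symm y))

instance : Mul (AnalyticSmash A H) := ⟨fun x y => analyticMulBilin A H x y⟩

instance : One (AnalyticSmash A H) := ⟨smashToAnalyticLinear A H 1⟩

theorem AnalyticSmash.mul_def (x y : AnalyticSmash A H) : x * y = analyticMulBilin A H x y := rfl

theorem AnalyticSmash.one_def : (1 : AnalyticSmash A H) = smashToAnalyticLinear A H 1 := rfl

instance : ContinuousMul (AnalyticSmash A H) := ⟨continuous_analyticMulBilin A H⟩

theorem smashToAnalyticLinear_mul (x y : SmashProduct A H) :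
    smashToAnalyticLinear A H (x * y) = smashToAnalyticLinear A H x * smashToAnalyticLinear A H y :=
  (analyticMulBilin_coe A H x y).symm

variable [IsModuleAlgebra H A]

instance : Ring (AnalyticSmash A H) :=
  { (inferInstance : AddCommGroup (AnalyticSmash A H)),
    (inferInstance : Mul (AnalyticSmash A H)), (inferInstance : One (AnalyticSmash A H)) with
    left_distrib := fun x y z => by simp only [AnalyticSmash.mul_def, map_add]
    right_distrib := fun x y z => by
      simp only [AnalyticSmash.mul_def, map_add, LinearMap.add_apply]
    zero_mul := fun x => by simp [AnalyticSmash.mul_def]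
    mul_zero := fun x => by simp [AnalyticSmash.mul_def]
    mul_assoc := fun x y z => by
      refine (denseRange_smashToAnalyticLinear A H).induction_on₃
        (p := fun x y z => x * y * z = x * (y * z)) ?_ ?_ x y z
      · exact isClosed_eq
          ((continuous_fst.mul (continuous_fst.comp continuous_snd)).mul
            (continuous_snd.comp continuous_snd))
          (continuous_fst.mul ((continuous_fst.comp continuous_snd).mul
            (continuous_snd.comp continuous_snd)))
      · intro a b c
        simp only [← smashToAnalyticLinear_mul, mul_assoc]
    one_mul := fun x => by
      refine (denseRange_smashToAnalyticLinear A H).induction_on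
        (p := fun x => 1 * x = x) x ?_ ?_
      · exact isClosed_eq (continuous_const.mul continuous_id) continuous_id
      · intro a
        rw [AnalyticSmash.one_def, ← smashToAnalyticLinear_mul, one_mul]
    mul_one := fun x => by
      refine (denseRange_smashToAnalyticLinear A H).induction_on
        (p := fun x => x * 1 = x) x ?_ ?_
      · exact isClosed_eq (continuous_id.mul continuous_const) continuous_id
      · intro a
        rw [AnalyticSmash.one_def, ← smashToAnalyticLinear_mul, mul_one] }

instance : Algebra ℂ (AnalyticSmash A H) :=
  Algebra.ofModule
    (fun c x y => by simp only [AnalyticSmash.mul_def, map_smul, LinearMap.smul_apply])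
    (fun c x y => by simp only [AnalyticSmash.mul_def, map_smul])

instance : IsTopologicalRing (AnalyticSmash A H) where
  continuous_add := continuous_add
  continuous_neg := continuous_neg

/-- The canonical homomorphism `A # H → Ã #̂ Ĥ`, `a ⊗ h ↦ a ⊗ h`. -/
def smashToAnalytic : SmashProduct A H →ₐ[ℂ] AnalyticSmash A H :=
  AlgHom.ofLinearMap (smashToAnalyticLinear A H) rfl (smashToAnalyticLinear_mul A H)

/-- The canonical homomorphism is given by `a ⊗ h ↦ a ⊗ h`. -/
theorem smashToAnalytic_tmul (a : A) (h : H) :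
    smashToAnalytic A H (toSmash A H (a ⊗ₜ h)) =
      ctmul _ _ (toHCompletion H A a) (toAMEnvelope H h) := rfl

end AnalyticSmash

end ArensMichael

end

/-! Both sides contain a dense image of `A ⊗ H`, so the matter is to compare two families of
seminorms on `A ⊗ H`: the submultiplicative seminorms of `A # H`, and the projective seminorms `p ⊗
q` with `p` an `H`-stable submultiplicative seminorm on `A` and `q` a submultiplicative seminorm on
`H`. Each family dominates the other.

From `p ⊗ q` to the smash product (`isStable_projSeminorm`, `exists_submult_projSeminorm_le`): `p ⊗
q` need not be submultiplicative for the twisted product, but left multiplication by a fixed element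
is bounded for it, because `h • ·` is bounded for `p` and a Sweedler sum is finite. The operator
seminorm `s` of the left regular representation is therefore finite and submultiplicative, and
evaluating operators at `1` gives `(p ⊗ q)(x) ≤ s(x) (p ⊗ q)(1)`. This half needs only a bialgebra.

From the smash product to `p ⊗ q` (`comp_tmul_one_mem_stableSeminorms`,
`IsSubmultiplicative.comp_one_tmul`): if `r` is submultiplicative on `A # H`, then `a ⊗ h = (a ⊗
1)(1 ⊗ h)` gives `r(a ⊗ h) ≤ r(a ⊗ 1) r(1 ⊗ h)`. The restriction of `r` to `A` is `H`-stable because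
the action becomes inner in `A # H`: `h • a = ∑ h₍₁₎ a S(h₍₂₎)` (`SmashProduct.smul_tmul_one`). This
is the only place where the antipode enters.

The two estimates give continuous linear maps in both directions between the completions. Both are
compatible with the canonical maps from `A # H`, so by density they are mutually inverse, and the
one out of the envelope is multiplicative. -/

namespace ArensMichael

/-! ### Product formulas in the smash product, and its submultiplicative seminorms. -/

section SmashSeminorms

variable {H A : Type*} [Ring H] [Ring A] [Algebra ℂ A] [Module H A]

section Bialgebra

variable [Bialgebra ℂ H] [IsScalarTower ℂ H A] [IsModuleAlgebra H A]

/-- A chosen representation `r` of `Δ h` turns the Sweedler notation into a finite sum, to which the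
triangle inequality for seminorms applies. -/
theorem SmashProduct.tmul_mul_tmul {ι : Type*} (a b : A) (h k : H) (r : Coalgebra.Repr ℂ h ι) :
    toSmash A H (a ⊗ₜ h) * toSmash A H (b ⊗ₜ k) =
      ∑ i ∈ r.index, toSmash A H ((a * r.left i • b) ⊗ₜ (r.right i * k)) :=
  (congrArg (toSmash A H) (smashMul_tmul a b h k r)).trans (map_sum _ _ _)

/-- The twist disappears because `h₍₁₎ • 1 = ε(h₍₁₎) 1` and `∑ ε(h₍₁₎) h₍₂₎ = h`. With `h = 1` this
is the factorization `a ⊗ k = (a ⊗ 1)(1 ⊗ k)`; with `a = 1` it says that `H` embeds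
multiplicatively. -/
theorem SmashProduct.tmul_mul_one_tmul (a : A) (h k : H) :
    toSmash A H (a ⊗ₜ h) * toSmash A H (1 ⊗ₜ k) = toSmash A H (a ⊗ₜ (h * k)) := by
  let r := Coalgebra.Repr.arbitrary ℂ h
  rw [SmashProduct.tmul_mul_tmul a 1 h k r, ← map_sum]
  congr 1
  simp only [IsModuleAlgebra.smul_one]
  simp_rw [← Algebra.commutes, ← Algebra.smul_def, TensorProduct.smul_tmul]
  rw [← TensorProduct.tmul_sum]
  simp_rw [← smul_mul_assoc]
  rw [← Finset.sum_mul, Coalgebra.sum_counit_smul r]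

/-- There is no twist since `Δ 1 = 1 ⊗ 1`. The case `k = 1` makes `a ↦ a ⊗ 1` multiplicative. -/
theorem SmashProduct.tmul_one_mul_tmul (a b : A) (k : H) :
    toSmash A H (a ⊗ₜ 1) * toSmash A H (b ⊗ₜ k) = toSmash A H ((a * b) ⊗ₜ k) := by
  rw [SmashProduct.tmul_mul_tmul a b 1 k reprOne]
  simp [reprOne]

/-- The commutation relation between the copies of `H` and `A`; it is what makes the action inner
once an antipode is available. -/
theorem SmashProduct.one_tmul_mul_tmul_one {ι : Type*} (a : A) (h : H)
    (r : Coalgebra.Repr ℂ h ι) :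
    toSmash A H (1 ⊗ₜ h) * toSmash A H (a ⊗ₜ 1) =
      ∑ i ∈ r.index, toSmash A H ((r.left i • a) ⊗ₜ r.right i) := by
  rw [SmashProduct.tmul_mul_tmul 1 a h 1 r]
  simp

/-- The projective seminorm `p ⊗ q` on the smash product is stable under left multiplication if
`p` and `q` are submultiplicative and `p` is `H`-stable. -/
theorem isStable_projSeminorm {p : Seminorm ℂ A} {q : Seminorm ℂ H}
    (hp : p ∈ stableSeminorms H A) (hq : IsSubmultiplicative q) :
    IsStable (SmashProduct A H) (SmashProduct A H)
      ((projSeminorm p q).comp (toSmash A H).symm.toLinearMap) := by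
  -- The elements whose left multiplication is bounded are closed under addition, so only elementary
  -- tensors need an estimate.
  suffices h : ∀ x : A ⊗[ℂ] H, ∃ C > 0, ∀ y : SmashProduct A H,
      (projSeminorm p q).comp (toSmash A H).symm.toLinearMap (toSmash A H x * y) ≤
        C * (projSeminorm p q).comp (toSmash A H).symm.toLinearMap y from h
  intro x
  induction x using TensorProduct.induction_on with
  | zero =>
    exact ⟨1, one_pos, fun y => by
      rw [map_zero, zero_mul, map_zero, one_mul]; exact apply_nonneg _ _⟩
  | add x x' hx hx' =>
    obtain ⟨C, hC, h⟩ := hx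
    obtain ⟨C', hC', h'⟩ := hx'
    refine ⟨C + C', add_pos hC hC', fun y => ?_⟩
    rw [map_add, add_mul, add_mul]
    exact (map_add_le_add _ _ _).trans (add_le_add (h y) (h' y))
  | tmul a h =>
    let r := Coalgebra.Repr.arbitrary ℂ h
    -- `C h` is a bound for the action of `h` with respect to `p`. No uniformity in `h` is required:
    -- only the finitely many `r.left i` occur.
    choose C hC hCp using hp.1
    have hnn : 0 ≤ ∑ i ∈ r.index, p a * C (r.left i) * q (r.right i) :=
      Finset.sum_nonneg fun i _ => mul_nonneg (mul_nonneg (apply_nonneg _ _) (hC _).le)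
        (apply_nonneg _ _)
    -- The sum is the bound obtained termwise from `p(a (h₍₁₎ • b)) q(h₍₂₎ k)`; the `+ 1` only
    -- secures strict positivity, as the sum may vanish.
    refine ⟨∑ i ∈ r.index, p a * C (r.left i) * q (r.right i) + 1, by linarith, fun y => ?_⟩
    -- Applied to the seminorm `y ↦ (p ⊗ q)((a ⊗ h) y)`: by the extremality of `p ⊗ q`, a bound on
    -- the elementary tensors `b ⊗ k` suffices.
    refine le_projSeminorm p q
      (((projSeminorm p q).comp (toSmash A H).symm.toLinearMap).comp
        (LinearMap.mulLeft ℂ (toSmash A H (a ⊗ₜ h)) ∘ₗ (toSmash A H).toLinearMap))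
      (by linarith) (fun b k => ?_) ((toSmash A H).symm y)
    simp only [Seminorm.comp_apply, LinearMap.comp_apply, LinearMap.mulLeft_apply,
      LinearEquiv.coe_coe]
    rw [SmashProduct.tmul_mul_tmul a b h k r, map_sum]
    simp only [LinearEquiv.symm_apply_apply]
    refine (Finset.le_sum_of_subadditive _ (map_zero _).le (map_add_le_add _) _ _).trans ?_
    calc ∑ i ∈ r.index, projSeminorm p q ((a * r.left i • b) ⊗ₜ (r.right i * k))
        ≤ ∑ i ∈ r.index, p a * C (r.left i) * q (r.right i) * (p b * q k) := by
          refine Finset.sum_le_sum fun i _ => (projSeminorm_tmul_le _ _ _ _).trans ?_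
          calc p (a * r.left i • b) * q (r.right i * k)
              ≤ (p a * (C (r.left i) * p b)) * (q (r.right i) * q k) := by
                refine mul_le_mul ((hp.2 _ _).trans ?_) (hq _ _) (apply_nonneg _ _)
                  (mul_nonneg (apply_nonneg _ _) (mul_nonneg (hC _).le (apply_nonneg _ _)))
                exact mul_le_mul_of_nonneg_left (hCp _ _) (apply_nonneg _ _)
            _ = _ := by ring
      _ = (∑ i ∈ r.index, p a * C (r.left i) * q (r.right i)) * (p b * q k) :=
          (Finset.sum_mul _ _ _).symm
      _ ≤ _ := mul_le_mul_of_nonneg_right (by linarith)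
          (mul_nonneg (apply_nonneg _ _) (apply_nonneg _ _))

/-- The projective seminorm `p ⊗ q` is dominated by a submultiplicative seminorm on the smash
product, namely by a multiple of the operator seminorm of the left regular representation. -/
theorem exists_submult_projSeminorm_le {p : Seminorm ℂ A} {q : Seminorm ℂ H}
    (hp : p ∈ stableSeminorms H A) (hq : IsSubmultiplicative q) :
    ∃ s ∈ submultSeminorms (SmashProduct A H), ∃ C : ℝ≥0, ∀ x : A ⊗[ℂ] H,
      projSeminorm p q x ≤ C * s (toSmash A H x) := by
  have hst := isStable_projSeminorm hp hq
  -- Here `A # H` plays both roles in `opSeminorm`, as the acting algebra and as the module. The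
  -- constant is `(p ⊗ q)(1)`, because the operator bound is applied to the vector `1`.
  refine ⟨opSeminorm _ hst, opSeminorm_submult _ hst,
    ⟨projSeminorm p q (1 ⊗ₜ 1), apply_nonneg _ _⟩, fun x => ?_⟩
  have h := le_opBounds_sInf hst (toSmash A H x) (toSmash A H (1 ⊗ₜ 1))
  rw [← SmashProduct.one_def, smul_eq_mul, mul_one, mul_comm] at h
  exact h

end Bialgebra

/-- A continuous seminorm is dominated by a multiple of a finite supremum of defining seminorms.
Closure of stability under suprema and multiples allows a single stable submultiplicative seminorm
to be used instead. -/
theorem IsStable.sup {p q : Seminorm ℂ A} (hp : IsStable H A p) (hq : IsStable H A q) :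
    IsStable H A (p ⊔ q) := by
  intro h
  obtain ⟨C, hC, h1⟩ := hp h
  obtain ⟨D, hD, h2⟩ := hq h
  refine ⟨max C D, lt_max_of_lt_left hC, fun a => ?_⟩
  simp only [Seminorm.sup_apply]
  have hCD : 0 ≤ max C D := (lt_max_of_lt_left hC).le
  refine max_le ((h1 a).trans ?_) ((h2 a).trans ?_)
  · exact mul_le_mul (le_max_left _ _) (le_max_left _ _) (apply_nonneg p a) hCD
  · exact mul_le_mul (le_max_right _ _) (le_max_right _ _) (apply_nonneg q a) hCD

theorem IsStable.finset_sup {ι : Type*} (p : ι → Seminorm ℂ A) (hp : ∀ i, IsStable H A (p i))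
    (s : Finset ι) : IsStable H A (s.sup p) := by
  refine Finset.sup_induction ?_ (fun _ h _ h' => h.sup h') fun i _ => hp i
  -- The empty supremum is the zero seminorm, for which any positive constant serves.
  exact fun h => ⟨1, one_pos, fun a => by simp⟩

theorem IsStable.smul {p : Seminorm ℂ A} (hp : IsStable H A p) (C : ℝ≥0) :
    IsStable H A (C • p) := by
  intro h
  obtain ⟨D, hD, h1⟩ := hp h
  refine ⟨D, hD, fun a => ?_⟩
  simp only [smul_apply, NNReal.smul_def, smul_eq_mul]
  rw [mul_left_comm]
  exact mul_le_mul_of_nonneg_left (h1 a) C.2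

/-- Each continuous seminorm on the `H`-completion is dominated on `A` by an `H`-stable
submultiplicative seminorm. -/
theorem exists_stable_le {r : Seminorm ℂ (HCompletion H A)} (hr : Continuous r) :
    ∃ p ∈ stableSeminorms H A, ∀ a, r (embed (stableSeminorms H A) a) ≤ p a := by
  obtain ⟨s, C, -, h⟩ := Seminorm.bound_of_continuous
    (SeminormTop.withSeminorms (stableSeminorms H A))
    (r.comp (toComplL (SeminormTop (stableSeminorms H A))).toLinearMap)
    (hr.comp (toComplL (SeminormTop (stableSeminorms H A))).continuous)
  have hs : IsSubmultiplicative (A := A) (s.sup fun p => p.1) :=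
    IsSubmultiplicative.finset_sup _ (fun i => i.2.2) s
  have ht : IsStable H A (s.sup fun p => p.1) := IsStable.finset_sup _ (fun i => i.2.1) s
  -- Stability survives any multiple, but submultiplicativity is only guaranteed for factors at
  -- least `1`; hence `max 1 C` in place of `C`.
  refine ⟨max 1 C • s.sup fun p => p.1, ⟨ht.smul _, hs.smul (le_max_left 1 C)⟩, fun a => ?_⟩
  refine (h (toSeminormTop (stableSeminorms H A) a)).trans ?_
  simp only [smul_apply, NNReal.smul_def, smul_eq_mul]
  exact mul_le_mul_of_nonneg_right (by exact_mod_cast le_max_right _ _)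
    (apply_nonneg (s.sup fun p => p.1) a)

/-! ### The adjoint formula and the restriction of seminorms to the two factors. -/

section HopfAlgebra

variable [HopfAlgebra ℂ H] [IsScalarTower ℂ H A] [IsModuleAlgebra H A]

/-- The action of `H` on `A` is the adjoint action inside the smash product:
`h • a = ∑ h₍₁₎ a S(h₍₂₎)`. -/
theorem SmashProduct.smul_tmul_one {ι : Type*} (h : H) (a : A) (r : Coalgebra.Repr ℂ h ι) :
    toSmash A H ((h • a) ⊗ₜ 1) =
      ∑ i ∈ r.index, toSmash A H (1 ⊗ₜ r.left i) * toSmash A H (a ⊗ₜ 1) *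
        toSmash A H (1 ⊗ₜ HopfAlgebraStruct.antipode ℂ (r.right i)) := by
  let r₁ := fun i => Coalgebra.Repr.arbitrary ℂ (r.left i)
  let r₂ := fun i => Coalgebra.Repr.arbitrary ℂ (r.right i)
  -- `Φ` sends `x ⊗ y ⊗ z` to `(x • a) ⊗ y S(z)` and is applied to the two bracketings of the
  -- iterated comultiplication of `h`. Splitting the right leg, `∑ h₍₂₎ S(h₍₃₎)` collapses to a
  -- counit and leaves `(h • a) ⊗ 1`; splitting the left leg produces the expansion of the adjoint
  -- expression.
  let Φ : H ⊗[ℂ] (H ⊗[ℂ] H) →ₗ[ℂ] A ⊗[ℂ] H :=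
    TensorProduct.map ((actionBilin H A).flip a)
      (LinearMap.mul' ℂ H ∘ₗ TensorProduct.map LinearMap.id (HopfAlgebraStruct.antipode ℂ))
  have h3 := congrArg Φ (Coalgebra.sum_tmul_tmul_eq r r₁ r₂)
  simp only [map_sum, Φ, TensorProduct.map_tmul, LinearMap.comp_apply, LinearMap.id_apply,
    LinearMap.mul'_apply, LinearMap.flip_apply, actionBilin_apply] at h3
  simp_rw [← TensorProduct.tmul_sum, HopfAlgebra.sum_mul_antipode_eq_smul,
    ← TensorProduct.smul_tmul, ← TensorProduct.sum_tmul, ← smul_assoc, ← Finset.sum_smul] at h3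
  -- The right counit law, which absorbs the scalars left over from `∑ h₍₂₎ S(h₍₃₎)`.
  have h4 : ∑ i ∈ r.index, Coalgebra.counit (R := ℂ) (r.right i) • r.left i = h := by
    have := congrArg (TensorProduct.rid ℂ H) (Coalgebra.sum_tmul_counit_eq r)
    simpa only [map_sum, TensorProduct.rid_tmul, one_smul] using this
  rw [h4] at h3
  rw [← h3, map_sum]
  refine Finset.sum_congr rfl fun i _ => ?_
  rw [SmashProduct.one_tmul_mul_tmul_one a (r.left i) (r₁ i), Finset.sum_mul, map_sum]
  simp only [SmashProduct.tmul_mul_one_tmul]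

/-- The restriction to `A` of a submultiplicative seminorm on the smash product is `H`-stable and
submultiplicative. -/
theorem comp_tmul_one_mem_stableSeminorms {r : Seminorm ℂ (SmashProduct A H)}
    (hr : IsSubmultiplicative r) :
    r.comp ((toSmash A H).toLinearMap ∘ₗ (TensorProduct.mk ℂ A H).flip 1) ∈
      stableSeminorms H A := by
  refine ⟨fun h => ?_, fun a b => ?_⟩
  · let s := Coalgebra.Repr.arbitrary ℂ h
    have hnn : 0 ≤ ∑ i ∈ s.index, r (toSmash A H (1 ⊗ₜ s.left i)) *
        r (toSmash A H (1 ⊗ₜ HopfAlgebraStruct.antipode ℂ (s.right i))) :=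
      Finset.sum_nonneg fun i _ => mul_nonneg (apply_nonneg _ _) (apply_nonneg _ _)
    -- The stability constant is read off the adjoint formula: `∑ r(h₍₁₎) r(S(h₍₂₎))`, which does
    -- not involve `a`. The `+ 1` again makes it strictly positive.
    refine ⟨∑ i ∈ s.index, r (toSmash A H (1 ⊗ₜ s.left i)) *
        r (toSmash A H (1 ⊗ₜ HopfAlgebraStruct.antipode ℂ (s.right i))) + 1, by linarith,
      fun a => ?_⟩
    change r (toSmash A H ((h • a) ⊗ₜ 1)) ≤ _ * r (toSmash A H (a ⊗ₜ 1))
    rw [SmashProduct.smul_tmul_one h a s, add_mul, Finset.sum_mul]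
    refine (Finset.le_sum_of_subadditive _ (map_zero _).le (map_add_le_add _) _ _).trans ((Finset.sum_le_sum fun i _ => ?_).trans
      (le_add_of_nonneg_right (mul_nonneg zero_le_one (apply_nonneg _ _))))
    refine (hr _ _).trans ((mul_le_mul_of_nonneg_right (hr _ _) (apply_nonneg _ _)).trans
      (le_of_eq ?_))
    ring
  · change r (toSmash A H ((a * b) ⊗ₜ 1)) ≤ _
    rw [← SmashProduct.tmul_one_mul_tmul]
    exact hr _ _

end HopfAlgebra

/-- The restriction to `H` of a submultiplicative seminorm on the smash product is
submultiplicative. -/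
theorem IsSubmultiplicative.comp_one_tmul [Bialgebra ℂ H] [IsScalarTower ℂ H A]
    [IsModuleAlgebra H A] {r : Seminorm ℂ (SmashProduct A H)} (hr : IsSubmultiplicative r) :
    IsSubmultiplicative (r.comp ((toSmash A H).toLinearMap ∘ₗ TensorProduct.mk ℂ A H 1)) := by
  intro h k
  change r (toSmash A H (1 ⊗ₜ (h * k))) ≤ _
  rw [← SmashProduct.tmul_mul_one_tmul]
  exact hr _ _

end SmashSeminorms

/-! ### The two continuous maps between the envelope and the analytic smash product. -/

section Comparison

variable (A H : Type*) [Ring H] [Ring A] [Algebra ℂ A] [Module H A]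

section Bialgebra

variable [Bialgebra ℂ H] [IsScalarTower ℂ H A] [IsModuleAlgebra H A]

/-- The canonical homomorphism `A # H → Ã #̂ Ĥ` on the topologized smash product. -/
noncomputable def seminormTopToAnalytic :
    SeminormTop (submultSeminorms (SmashProduct A H)) →ₗ[ℂ] AnalyticSmash A H :=
  smashToAnalyticLinear A H ∘ₗ
    (toSeminormTop (submultSeminorms (SmashProduct A H))).symm.toLinearMap

/-- A continuous seminorm on `Ã ⊗̂ Ĥ` restricts to `A ⊗ H` below some `p' ⊗ q'` with `p'` stable and
submultiplicative and `q'` submultiplicative, and the regular representation puts a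
submultiplicative seminorm of `A # H` above a scalar multiple of it. -/
theorem continuous_seminormTopToAnalytic : Continuous (seminormTopToAnalytic A H) := by
  refine (PolynormableSpace.withSeminorms ℂ (AnalyticSmash A H)).continuous_of_continuous_comp _ ?_
  rintro ⟨r, hr⟩
  obtain ⟨p, hp, q, hq, h⟩ := exists_bound_of_continuous_bilin
    (ctmul (HCompletion H A) (AMEnvelope H)) continuous_ctmul
    (r := (r : Seminorm ℂ (CProj (HCompletion H A) (AMEnvelope H)))) hr
  obtain ⟨p', hp', hpp'⟩ := exists_stable_le hp
  obtain ⟨q', hq', hqq'⟩ := exists_submult_le hq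
  obtain ⟨s, hs, C, hC⟩ := exists_submult_projSeminorm_le hp' hq'
  have hcont : Continuous
      (C • SeminormTop.seminorm (submultSeminorms (SmashProduct A H)) ⟨s, hs⟩) :=
    ((SeminormTop.withSeminorms
      (submultSeminorms (SmashProduct A H))).continuous_seminorm ⟨s, hs⟩).const_smul C
  refine Seminorm.continuous_of_le hcont fun x => ?_
  -- The chain is `r ≤ p' ⊗ q' ≤ C s`. The second inequality is used here; the first follows from
  -- extremality of the projective seminorm and the bounds on elementary tensors.
  refine le_trans ?_ (hC ((toSmash A H).symm
    ((toSeminormTop (submultSeminorms (SmashProduct A H))).symm x)))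
  rw [← one_mul (projSeminorm p' q' _)]
  exact le_projSeminorm p' q' (Seminorm.comp r (toHatTensor A H)) zero_le_one
    (fun a k => by
      rw [one_mul]
      exact (h _ _).trans (mul_le_mul (hpp' a) (hqq' k) (apply_nonneg q _) (apply_nonneg p' _))) _

instance : UniformContinuousConstSMul ℂ (AnalyticSmash A H) :=
  uniformContinuousConstSMul_of_continuousConstSMul _ _

/-- The continuous extension `(A # H)^ → Ã #̂ Ĥ` of the canonical homomorphism. -/
noncomputable def envelopeToAnalytic : AMEnvelope (SmashProduct A H) →L[ℂ] AnalyticSmash A H :=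
  ContinuousLinearMap.fromCompletion
    ⟨seminormTopToAnalytic A H, continuous_seminormTopToAnalytic A H⟩

theorem envelopeToAnalytic_coe (x : SmashProduct A H) :
    envelopeToAnalytic A H (toAMEnvelope (SmashProduct A H) x) = smashToAnalytic A H x :=
  ContinuousLinearMap.fromCompletion_apply_coe _
    (toSeminormTop (submultSeminorms (SmashProduct A H)) x)

/-- Both sides are jointly continuous with values in a Hausdorff space and agree on the dense image
of `A # H`, where the canonical map is a homomorphism. -/
theorem envelopeToAnalytic_mul (x y : AMEnvelope (SmashProduct A H)) :
    envelopeToAnalytic A H (x * y) = envelopeToAnalytic A H x * envelopeToAnalytic A H y := by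
  refine (denseRange_toSeminormCompletion
    (submultSeminorms (SmashProduct A H))).induction_on₂
    (p := fun x y => envelopeToAnalytic A H (x * y) =
      envelopeToAnalytic A H x * envelopeToAnalytic A H y) ?_ ?_ x y
  · exact isClosed_eq ((envelopeToAnalytic A H).continuous.comp continuous_mul)
      (((envelopeToAnalytic A H).continuous.comp continuous_fst).mul
        ((envelopeToAnalytic A H).continuous.comp continuous_snd))
  · intro a b
    rw [← map_mul, envelopeToAnalytic_coe, envelopeToAnalytic_coe, envelopeToAnalytic_coe, map_mul]

end Bialgebra

variable [HopfAlgebra ℂ H] [IsScalarTower ℂ H A] [IsModuleAlgebra H A]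

/-- The bilinear map `(a, h) ↦ a ⊗ h` from `A × H` to the Arens–Michael envelope of `A # H`. -/
noncomputable def envelopeBilin : SeminormTop (stableSeminorms H A) →ₗ[ℂ] SeminormTop (submultSeminorms H) →ₗ[ℂ]
    AMEnvelope (SmashProduct A H) :=
  (((TensorProduct.mk ℂ A H).compr₂ (toSmash A H).toLinearMap).compl₁₂
    (toSeminormTop (stableSeminorms H A)).symm.toLinearMap
    (toSeminormTop (submultSeminorms H)).symm.toLinearMap).compr₂
    (toAMEnvelope (SmashProduct A H)).toLinearMap

/-- Joint continuity is the inequality `r(a ⊗ k) ≤ r(a ⊗ 1) r(1 ⊗ k)`, whose factors are defining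
seminorms of the topologies of `A` and `H`. Stability of the first factor is where the antipode is
needed. -/
theorem continuous_envelopeBilin : Continuous
    fun z : SeminormTop (stableSeminorms H A) × SeminormTop (submultSeminorms H) =>
      envelopeBilin A H z.1 z.2 := by
  have h : Continuous
      fun z : SeminormTop (stableSeminorms H A) × SeminormTop (submultSeminorms H) =>
      ((((TensorProduct.mk ℂ A H).compr₂ (toSmash A H).toLinearMap).compl₁₂
        (toSeminormTop (stableSeminorms H A)).symm.toLinearMap
        (toSeminormTop (submultSeminorms H)).symm.toLinearMap).compr₂
        (toSeminormTop (submultSeminorms (SmashProduct A H))).toLinearMap) z.1 z.2 := by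
    refine continuous_bilin_of_bound
      (SeminormTop.withSeminorms (submultSeminorms (SmashProduct A H))) _ ?_
    rintro ⟨r, hr⟩
    refine ⟨_, (SeminormTop.withSeminorms (stableSeminorms H A)).continuous_seminorm
      ⟨_, comp_tmul_one_mem_stableSeminorms hr⟩, _,
      (SeminormTop.withSeminorms (submultSeminorms H)).continuous_seminorm
      ⟨_, hr.comp_one_tmul⟩, fun a k => ?_⟩
    have h1 := hr (toSmash A H ((toSeminormTop (stableSeminorms H A)).symm a ⊗ₜ 1))
      (toSmash A H (1 ⊗ₜ (toSeminormTop (submultSeminorms H)).symm k))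
    rw [SmashProduct.tmul_mul_one_tmul, one_mul] at h1
    exact h1
  exact (Completion.continuous_coe (SeminormTop (submultSeminorms (SmashProduct A H)))).comp h

/-- The continuous linear map `Ã #̂ Ĥ → (A # H)^` induced by `(a, h) ↦ a ⊗ h`. -/
noncomputable def analyticToEnvelope : AnalyticSmash A H →L[ℂ] AMEnvelope (SmashProduct A H) :=
  CProj.lift (extendBilin (envelopeBilin A H) (continuous_envelopeBilin A H))
    (continuous_extendBilin (envelopeBilin A H) (continuous_envelopeBilin A H))

/-- It suffices to compare linear maps on elementary tensors, where the lift and the extension to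
the completions both reduce to `envelopeBilin`. -/
theorem analyticToEnvelope_coe (x : SmashProduct A H) :
    analyticToEnvelope A H (smashToAnalytic A H x) = toAMEnvelope (SmashProduct A H) x := by
  suffices h : (analyticToEnvelope A H).toLinearMap ∘ₗ
      (smashToAnalyticLinear A H ∘ₗ (toSmash A H).toLinearMap) =
      (toAMEnvelope (SmashProduct A H)).toLinearMap ∘ₗ (toSmash A H).toLinearMap from
    DFunLike.congr_fun h ((toSmash A H).symm x)
  refine TensorProduct.ext' fun a k => ?_
  refine (CProj.lift_ctmul (extendBilin (envelopeBilin A H) (continuous_envelopeBilin A H))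
    (continuous_extendBilin (envelopeBilin A H) (continuous_envelopeBilin A H)) _ _).trans ?_
  exact extendBilin_coe (envelopeBilin A H) (continuous_envelopeBilin A H)
    (toSeminormTop (stableSeminorms H A) a) (toSeminormTop (submultSeminorms H) k)

/-- The composite is continuous and fixes the dense image of `A # H`, hence is the identity; the
opposite composite is treated in the same way, with density in `Ã ⊗̂ Ĥ`. -/
theorem analyticToEnvelope_envelopeToAnalytic (x : AMEnvelope (SmashProduct A H)) :
    analyticToEnvelope A H (envelopeToAnalytic A H x) = x := by
  refine (denseRange_toSeminormCompletion (submultSeminorms (SmashProduct A H))).induction_on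
    (p := fun x => analyticToEnvelope A H (envelopeToAnalytic A H x) = x) x ?_ ?_
  · exact isClosed_eq ((analyticToEnvelope A H).continuous.comp
      (envelopeToAnalytic A H).continuous) continuous_id
  · intro a
    rw [envelopeToAnalytic_coe, analyticToEnvelope_coe]

theorem envelopeToAnalytic_analyticToEnvelope (x : AnalyticSmash A H) :
    envelopeToAnalytic A H (analyticToEnvelope A H x) = x := by
  refine (denseRange_smashToAnalyticLinear A H).induction_on
    (p := fun x => envelopeToAnalytic A H (analyticToEnvelope A H x) = x) x ?_ ?_
  · exact isClosed_eq ((envelopeToAnalytic A H).continuous.comp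
      (analyticToEnvelope A H).continuous) continuous_id
  · intro a
    change envelopeToAnalytic A H (analyticToEnvelope A H (smashToAnalytic A H a)) =
      smashToAnalytic A H a
    rw [analyticToEnvelope_coe, envelopeToAnalytic_coe]

/-- The isomorphism of topological algebras `(A # H)^ ≅ Ã #̂ Ĥ`. -/
noncomputable def envelopeEquivAnalytic : AMEnvelope (SmashProduct A H) ≃A[ℂ] AnalyticSmash A H where
  toFun := envelopeToAnalytic A H
  invFun := analyticToEnvelope A H
  left_inv := analyticToEnvelope_envelopeToAnalytic A H
  right_inv := envelopeToAnalytic_analyticToEnvelope A H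
  -- Multiplicativity is needed in one direction only, since the inverse of a bijective homomorphism
  -- is again one.
  map_mul' := envelopeToAnalytic_mul A H
  map_add' := map_add _
  commutes' c := (envelopeToAnalytic_coe A H (algebraMap ℂ _ c)).trans
    ((smashToAnalytic A H).commutes c)
  continuous_toFun := (envelopeToAnalytic A H).continuous
  continuous_invFun := (analyticToEnvelope A H).continuous

end Comparison

end ArensMichael

theorem theorem3p1 {H A : Type*} [Ring H] [HopfAlgebra ℂ H] [Ring A] [Algebra ℂ A] [Module H A]
    [IsScalarTower ℂ H A] [ArensMichael.IsModuleAlgebra H A] :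
    ∃ Φ : ArensMichael.AMEnvelope (ArensMichael.SmashProduct A H) ≃A[ℂ]
        ArensMichael.AnalyticSmash A H,
      ∀ x : ArensMichael.SmashProduct A H,
        Φ (ArensMichael.toAMEnvelope (ArensMichael.SmashProduct A H) x) =
          ArensMichael.smashToAnalytic A H x :=
  ⟨ArensMichael.envelopeEquivAnalytic A H, ArensMichael.envelopeToAnalytic_coe A H⟩
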